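/- For \(N\ge 5\) let \(|H^5_N\rangle=\prod_{e\subseteq\{1,\dots,N\},\,|e|=5}C_e\,|+\rangle^{\otimes N}\) be the five-uniform complete \(N\)-qubit hypergraph state, where \(|+\rangle=(|0\rangle+|1\rangle)/\sqrt2\) and \(C_e=\mathbb 1-2|1\cdots1\rangle\langle1\cdots1|\) (the projector acting on the qubits in \(e\), the identity on the others). For an \(N\)-qubit state \(|\psi\rangle\) let \[E_G(|\psi\rangle)=1-\max_{\phi_1,\dots,\phi_N}\bigl|\langle\phi_1\otimes\cdots\otimes\phi_N|\psi\rangle\bigr|^2\] be the geometric measure of entanglement, the maximum running over all unit vectors \(\phi_1,\dots,\phi_N\in\mathbb C^2\). Let \(X\) and \(Y\) be the Pauli operators, say that \(|\psi\rangle\) is stabilised by an operator \(A\) if \(A|\psi\rangle=|\psi\rangle\), and put \[\lambda_N=\frac{1}{\sqrt2}\Bigl(\cos^N\frac{\pi}{8}-\sin^N\frac{\pi}{8}\Bigr).\] Then: 1. If \(|H^5_N\rangle\) is stabilised by \(X^{\otimes N}\), then \(E_G(|H^5_N\rangle)=\frac34-\lambda_N-\lambda_N^2\). 2. If \(|H^5_N\rangle\)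 is stabilised by \(Y^{\otimes N}\), then \(\frac34-\lambda_N-\lambda_N^2\le E_G(|H^5_N\rangle)\le\frac34\). -/

import Mathlib

/-!
Pure states of `N` qubits are vectors of `EuclideanSpace ℂ (Fin N → Fin 2)`; the coordinate at
`x : Fin N → Fin 2` is the amplitude of the computational basis vector `|x_1 … x_N⟩`.
-/

noncomputable section

namespace QHyper

/-- The Hilbert space of one qubit. -/
abbrev Qubit : Type := EuclideanSpace ℂ (Fin 2)

/-- The Hilbert space of `N` qubits. -/
abbrev Ket (N : ℕ) : Type := EuclideanSpace ℂ (Fin N → Fin 2)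

/-- Operators on `N` qubits, as matrices in the computational basis. -/
abbrev Operator (N : ℕ) : Type := Matrix (Fin N → Fin 2) (Fin N → Fin 2) ℂ

/-- The product vector `φ_1 ⊗ … ⊗ φ_N`. -/
def productKet {N : ℕ} (φ : Fin N → Qubit) : Ket N :=
  WithLp.toLp 2 fun x => ∏ i, φ i (x i)

/-- The tensor product `A_1 ⊗ … ⊗ A_N` of one-qubit operators. -/
def tensorOp {N : ℕ} (A : Fin N → Matrix (Fin 2) (Fin 2) ℂ) : Operator N :=
  Matrix.of fun x y => ∏ i, A i (x i) (y i)

/-- The Pauli operator `X = σ_x`. -/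
def pauliX : Matrix (Fin 2) (Fin 2) ℂ := !![0, 1; 1, 0]

/-- The Pauli operator `Y = σ_y`. -/
def pauliY : Matrix (Fin 2) (Fin 2) ℂ := !![0, -Complex.I; Complex.I, 0]

/-- The projector `|1⟩⟨1|`. -/
def projOne : Matrix (Fin 2) (Fin 2) ℂ := !![0, 0; 0, 1]

/-- The state `|+⟩ = (|0⟩ + |1⟩) / √2`. -/
def ketPlus : Qubit := !₂[(1 / (Real.sqrt 2 : ℂ)), (1 / (Real.sqrt 2 : ℂ))]

/-- The generalized controlled-`Z` gate `C_e = 1 - 2 |1…1⟩⟨1…1|` on the qubits in `e`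
(the projector acts on the qubits in `e`, the identity on all others). -/
def gate {N : ℕ} (e : Finset (Fin N)) : Operator N :=
  1 - (2 : ℂ) • tensorOp fun i => if i ∈ e then projOne else 1

theorem gate_eq_diagonal {N : ℕ} (e : Finset (Fin N)) :
    gate e = Matrix.diagonal fun x : Fin N → Fin 2 => if ∀ i ∈ e, x i = 1 then (-1 : ℂ) else 1 := by
  ext x y
  have key : ∀ i, (if i ∈ e then projOne else 1 : Matrix (Fin 2) (Fin 2) ℂ) (x i) (y i)
      = if x i = y i ∧ (i ∈ e → x i = 1) then 1 else 0 := by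
    intro i
    generalize x i = a
    generalize y i = b
    by_cases hi : i ∈ e <;> fin_cases a <;> fin_cases b <;> simp [hi, projOne]
  simp only [gate, tensorOp, Matrix.sub_apply, Matrix.smul_apply, Matrix.of_apply, key,
    Matrix.diagonal_apply, Matrix.one_apply, smul_eq_mul]
  rw [Finset.prod_ite_zero]
  by_cases hxy : x = y
  · subst hxy
    by_cases h : ∀ i ∈ e, x i = 1
    · have : ∀ i ∈ Finset.univ, x i = x i ∧ (i ∈ e → x i = 1) := fun i _ => ⟨rfl, h i⟩
      rw [if_pos this, if_pos h]
      norm_num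
    · have : ¬ ∀ i ∈ Finset.univ, x i = x i ∧ (i ∈ e → x i = 1) :=
        fun H => h fun i hi => (H i (Finset.mem_univ i)).2 hi
      rw [if_neg this, if_neg h]
      norm_num
  · have : ¬ ∀ i ∈ Finset.univ, x i = y i ∧ (i ∈ e → x i = 1) :=
      fun H => hxy (funext fun i => (H i (Finset.mem_univ i)).1)
    rw [if_neg this]
    simp [hxy]

theorem gate_pairwise_commute {N : ℕ} (E : Finset (Finset (Fin N))) :
    (E : Set (Finset (Fin N))).Pairwise (Function.onFun Commute gate) := by
  intro e _ e' _ _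
  change gate e * gate e' = gate e' * gate e
  rw [gate_eq_diagonal, gate_eq_diagonal, Matrix.diagonal_mul_diagonal,
    Matrix.diagonal_mul_diagonal]
  congr 1
  funext x
  exact mul_comm _ _

/-- The hypergraph state `∏_{e ∈ E} C_e |+⟩^{⊗ N}` of the hypergraph with vertices `Fin N` and set
of hyperedges `E`. The gates commute, so their product needs no order. -/
def hypergraphState {N : ℕ} (E : Finset (Finset (Fin N))) : Ket N :=
  Matrix.toEuclideanLin (E.noncommProd gate (gate_pairwise_commute E))
    (productKet fun _ => ketPlus)

/-- The `k`-uniform complete `N`-qubit hypergraph state: all hyperedges of cardinality `k`. -/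
def uniformCompleteState (k N : ℕ) : Ket N :=
  hypergraphState (Finset.univ.powersetCard k)

/-- `ψ` is stabilised by `A`, i.e. it is an eigenvector of `A` with eigenvalue `+1`. -/
def IsStabilisedBy {N : ℕ} (ψ : Ket N) (A : Operator N) : Prop :=
  Matrix.toEuclideanLin A ψ = ψ

/-- The squared overlaps `|⟨φ|ψ⟩|²` of `ψ` with the product states `φ = φ_1 ⊗ … ⊗ φ_N`, where all
`φ_i` are normalized. -/
def productOverlaps {N : ℕ} (ψ : Ket N) : Set ℝ :=
  {t | ∃ φ : Fin N → Qubit, (∀ i, ‖φ i‖ = 1) ∧ t = ‖inner ℂ (productKet φ) ψ‖ ^ 2}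

/-- The maximum over product states is attained. -/
theorem isGreatest_productOverlaps {N : ℕ} (ψ : Ket N) :
    IsGreatest (productOverlaps ψ) (sSup (productOverlaps ψ)) := by
  have himg : productOverlaps ψ = (fun φ : Fin N → Qubit => ‖inner ℂ (productKet φ) ψ‖ ^ 2) ''
      Set.univ.pi fun _ => Metric.sphere (0 : Qubit) 1 := by
    ext t
    constructor
    · rintro ⟨φ, hφ, rfl⟩
      exact ⟨φ, fun i _ => by simpa using hφ i, rfl⟩
    · rintro ⟨φ, hφ, rfl⟩
      exact ⟨φ, fun i => by simpa using hφ i (Set.mem_univ i), rfl⟩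
  have hcont : Continuous fun φ : Fin N → Qubit => ‖inner ℂ (productKet φ) ψ‖ ^ 2 := by
    have : Continuous fun φ : Fin N → Qubit => productKet φ := by
      unfold productKet
      fun_prop
    fun_prop
  have hcomp : IsCompact (productOverlaps ψ) := by
    rw [himg]
    exact (isCompact_univ_pi fun _ => isCompact_sphere 0 1).image hcont
  refine hcomp.isGreatest_sSup ?_
  exact ⟨_, fun _ => EuclideanSpace.single 0 1, fun _ => by simp, rfl⟩

/-- The geometric measure of entanglement `E_G(ψ) = 1 - max_φ |⟨φ|ψ⟩|²`, the maximum being over all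
product states `φ`. -/
def geometricMeasure {N : ℕ} (ψ : Ket N) : ℝ :=
  1 - sSup (productOverlaps ψ)

/-- `λ_N = (cos^N(π/8) - sin^N(π/8)) / √2`. -/
def lam (N : ℕ) : ℝ :=
  (1 / Real.sqrt 2) * (Real.cos (Real.pi / 8) ^ N - Real.sin (Real.pi / 8) ^ N)

end QHyper

end

noncomputable section

namespace QHyper

open Finset

-- Constants at the angle π/8.

local notation "𝖼" => Real.cos (Real.pi / 8)
local notation "𝗌" => Real.sin (Real.pi / 8)
local notation "ζ" => Complex.exp (Real.pi / 8 * Complex.I)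

/-! The sign `(-1) ^ w.choose 5` depends only on `w` mod 8, so a finite Fourier expansion writes the
state as a combination of six symmetric product vectors. In the basis |+⟩, |-⟩ two of them form a
GHZ part of weight 1/2, and the other four have coordinates built from `𝖼`, `𝗌` and powers of `ζ` =
e^{iπ/8}. Comparing a few amplitudes under a global bit flip shows that stabilisation by X^{⊗N}
forces N ≡ 4 mod 8, and by Y^{⊗N} forces N ≡ 0 mod 8. In these classes the phases simplify: beyond
the GHZ part only even, respectively odd, numbers of minus signs carry amplitude.

For the bound on overlaps, replace amplitudes and vectors by absolute values. The amplitudes are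
dominated by a nonnegative symmetric tensor that is again a sum of six product vectors
(`evenMajorant`, `oddMajorant`). Averaging squared coordinates pairwise shows that its maximum over
nonnegative product vectors is attained at a symmetric one (`sum_mul_prod_le_of_symmetric`). What
remains is the two-variable inequality `profile_le`: a form in p², q² is at most (1/2 + λ_N)(p² +
q²)^n, where N = 2n. For n ≤ 27 it holds coefficient by coefficient, by integer arithmetic; for n ≥
28 crude estimates work away from the axes, and convexity in (q/p)² near them. The odd form is
dominated by the even one (`oddProfile_le`).

The bound 1/2 + λ_N is an actual amplitude at |+⟩^{⊗N} or |-⟩^{⊗N} when N ≡ 4 mod 8, which gives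
equality. When N ≡ 0 mod 8 the overlap with |+⟩^{⊗N} is only 1/2, hence the upper bound 3/4. -/

theorem cos_sq_pi_div_eight : 𝖼 ^ 2 = (2 + √2) / 4 := by
  rw [Real.cos_pi_div_eight, div_pow, Real.sq_sqrt (by positivity)]
  norm_num

theorem sin_sq_pi_div_eight : 𝗌 ^ 2 = (2 - √2) / 4 := by
  have h : √2 ≤ 2 := Real.sqrt_le_iff.2 ⟨by norm_num, by norm_num⟩
  rw [Real.sin_pi_div_eight, div_pow, Real.sq_sqrt (by linarith)]
  norm_num

theorem cos_pi_div_eight_pos : 0 < 𝖼 :=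
  Real.cos_pos_of_mem_Ioo ⟨by linarith [Real.pi_pos], by linarith [Real.pi_pos]⟩

theorem sin_pi_div_eight_pos : 0 < 𝗌 :=
  Real.sin_pos_of_pos_of_lt_pi (by linarith [Real.pi_pos]) (by linarith [Real.pi_pos])

theorem two_mul_cos_mul_sin_pi_div_eight : 2 * 𝖼 * 𝗌 = √2 / 2 := by
  have h := Real.sin_two_mul (Real.pi / 8)
  rw [show 2 * (Real.pi / 8) = Real.pi / 4 by ring, Real.sin_pi_div_four] at h
  linarith

theorem cos_eq_sin_add_pi_div_eight : 𝖼 = 𝗌 + √2 * 𝗌 := by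
  have h1 := two_mul_cos_mul_sin_pi_div_eight
  have h2 := sin_sq_pi_div_eight
  have h3 : √2 ^ 2 = 2 := Real.sq_sqrt (by norm_num)
  have h4 : 𝗌 * (𝖼 - (𝗌 + √2 * 𝗌)) = 0 := by
    have : 𝗌 * (𝖼 - (𝗌 + √2 * 𝗌)) = (2 * 𝖼 * 𝗌) / 2 - 𝗌 ^ 2 * (1 + √2) := by ring
    rw [this, h1, h2]
    nlinarith
  rcases mul_eq_zero.1 h4 with h | h
  · exact absurd h sin_pi_div_eight_pos.ne'
  · linarith

theorem sin_le_cos_pi_div_eight : 𝗌 ≤ 𝖼 := by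
  rw [cos_eq_sin_add_pi_div_eight]
  have := sin_pi_div_eight_pos
  have : 0 ≤ √2 * 𝗌 := by positivity
  linarith

theorem lam_nonneg (N : ℕ) : 0 ≤ lam N := by
  unfold lam
  have : 𝗌 ^ N ≤ 𝖼 ^ N := pow_le_pow_left₀ sin_pi_div_eight_pos.le sin_le_cos_pi_div_eight N
  have h2 : 0 ≤ 1 / √2 := by positivity
  exact mul_nonneg h2 (by linarith)

/-! ### The majorising form in p², q² and its coefficients. -/

/-- The weight of the two GHZ components after the other four product vectors have been
given nonnegative signs. -/
def ghzWeight (N : ℕ) : ℝ := 1 / 2 - √2 * 𝗌 ^ N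

/-- The overlap of the majorising nonnegative symmetric tensor with `(p, q)^{⊗ 2n}`. -/
def profile (n : ℕ) (p q : ℝ) : ℝ :=
  ghzWeight (2 * n) * (p ^ (2 * n) + q ^ (2 * n)) +
    1 / (2 * √2) * ((𝖼 * p + 𝗌 * q) ^ (2 * n) + (𝖼 * p - 𝗌 * q) ^ (2 * n) +
      (𝗌 * p + 𝖼 * q) ^ (2 * n) + (𝗌 * p - 𝖼 * q) ^ (2 * n))

/-- The coefficients of `profile` as a homogeneous polynomial in `p ^ 2` and `q ^ 2`. -/
def profileCoeff (n j : ℕ) : ℝ :=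
  ghzWeight (2 * n) * ((if j = 0 then 1 else 0) + (if j = n then 1 else 0)) +
    1 / √2 * ((2 * n).choose (2 * j) *
      ((𝖼 ^ 2) ^ (n - j) * (𝗌 ^ 2) ^ j + (𝗌 ^ 2) ^ (n - j) * (𝖼 ^ 2) ^ j))

theorem sum_range_two_mul_add_one (g : ℕ → ℝ) (n : ℕ) :
    ∑ k ∈ range (2 * n + 1), g k
      = ∑ j ∈ range (n + 1), g (2 * j) + ∑ j ∈ range n, g (2 * j + 1) := by
  induction n with
  | zero => simp
  | succ n ih =>
    rw [show 2 * (n + 1) + 1 = 2 * n + 1 + 1 + 1 by ring, sum_range_succ, sum_range_succ, ih,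
      sum_range_succ _ (n + 1), sum_range_succ _ n, show 2 * (n + 1) = 2 * n + 1 + 1 by ring,
      sum_range_succ (fun j => g (2 * j + 1)) n]
    ring

theorem add_pow_two_mul_add_sub_pow (a b : ℝ) (n : ℕ) :
    (a + b) ^ (2 * n) + (a - b) ^ (2 * n)
      = 2 * ∑ j ∈ range (n + 1), ((2 * n).choose (2 * j) : ℝ) * ((a ^ 2) ^ (n - j) * (b ^ 2) ^ j) := by
  rw [sub_eq_add_neg, add_comm a, add_comm a, add_pow, add_pow, ← sum_add_distrib,
    sum_range_two_mul_add_one, mul_sum]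
  have h2 : ∑ j ∈ range n, (b ^ (2 * j + 1) * a ^ (2 * n - (2 * j + 1)) * ((2 * n).choose (2 * j + 1) : ℝ)
      + (-b) ^ (2 * j + 1) * a ^ (2 * n - (2 * j + 1)) * ((2 * n).choose (2 * j + 1) : ℝ)) = 0 := by
    refine sum_eq_zero fun j _ => ?_
    rw [Odd.neg_pow ⟨j, rfl⟩]
    ring
  rw [h2, add_zero]
  refine sum_congr rfl fun j _ => ?_
  rw [Even.neg_pow ⟨j, two_mul j⟩, ← pow_mul, ← pow_mul, Nat.mul_sub]
  ring

theorem profile_eq_sum (n : ℕ) (p q : ℝ) :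
    profile n p q
      = ∑ j ∈ range (n + 1), profileCoeff n j * ((p ^ 2) ^ (n - j) * (q ^ 2) ^ j) := by
  have h0 : ∑ j ∈ range (n + 1),
      (if j = 0 then (1 : ℝ) else 0) * ((p ^ 2) ^ (n - j) * (q ^ 2) ^ j) = p ^ (2 * n) := by
    simp [ite_mul, sum_ite_eq', ← pow_mul]
  have h1 : ∑ j ∈ range (n + 1),
      (if j = n then (1 : ℝ) else 0) * ((p ^ 2) ^ (n - j) * (q ^ 2) ^ j) = q ^ (2 * n) := by
    simp [ite_mul, sum_ite_eq', ← pow_mul]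
  have h2 := add_pow_two_mul_add_sub_pow (𝖼 * p) (𝗌 * q) n
  have h3 := add_pow_two_mul_add_sub_pow (𝗌 * p) (𝖼 * q) n
  unfold profile
  rw [add_assoc _ ((𝗌 * p + 𝖼 * q) ^ (2 * n)), h2, h3, ← h0, ← h1, ← mul_add,
    ← sum_add_distrib, ← sum_add_distrib, ← mul_assoc, mul_sum, mul_sum, ← sum_add_distrib]
  refine sum_congr rfl fun j _ => ?_
  unfold profileCoeff
  have : 1 / (2 * √2) * 2 = 1 / √2 := by field_simp
  rw [this]
  simp only [mul_pow]
  ring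

/-- The correction -√2 𝗌^N in `ghzWeight` turns (𝖼^N + 𝗌^N)/√2 into `lam N`, so the majorant loses
nothing at the extremal point (1, 0). -/
theorem profileCoeff_zero {n : ℕ} (hn : n ≠ 0) : profileCoeff n 0 = 1 / 2 + lam (2 * n) := by
  have h2 : √2 ^ 2 = 2 := Real.sq_sqrt (by norm_num)
  have h0 : √2 ≠ 0 := by positivity
  simp only [profileCoeff, ghzWeight, lam, hn.symm, ← pow_mul, if_true, if_false, mul_zero,
    Nat.sub_zero, Nat.choose_zero_right, pow_zero, Nat.cast_one]
  field_simp
  linear_combination (-2 * 𝗌 ^ (2 * n)) * h2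

theorem profileCoeff_symm {n j : ℕ} (hj : j ≤ n) : profileCoeff n (n - j) = profileCoeff n j := by
  unfold profileCoeff
  rw [Nat.sub_sub_self hj, Nat.mul_sub, Nat.choose_symm (by omega)]
  have h1 : (n - j = 0) = (j = n) := propext (by omega)
  have h2 : (n - j = n) = (j = 0) := propext (by omega)
  simp only [h1, h2]
  ring

/-! ### Coefficientwise comparison for n ≤ 27. -/

/-- `(2 + √2) ^ m = u + v √2` with `(u, v) = sqrtTwoPow m`. -/
def sqrtTwoPow : ℕ → ℕ × ℕ
  | 0 => (1, 0)
  | m + 1 => (2 * (sqrtTwoPow m).1 + 2 * (sqrtTwoPow m).2, (sqrtTwoPow m).1 + 2 * (sqrtTwoPow m).2)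

theorem two_add_sqrt_two_pow (m : ℕ) :
    (2 + √2) ^ m = (sqrtTwoPow m).1 + (sqrtTwoPow m).2 * √2 := by
  have h2 : √2 ^ 2 = 2 := Real.sq_sqrt (by norm_num)
  induction m with
  | zero => simp [sqrtTwoPow]
  | succ m ih =>
    rw [pow_succ, ih, sqrtTwoPow]
    push_cast
    linear_combination (sqrtTwoPow m).2 * h2

theorem two_sub_sqrt_two_pow (m : ℕ) :
    (2 - √2) ^ m = (sqrtTwoPow m).1 - (sqrtTwoPow m).2 * √2 := by
  have h2 : √2 ^ 2 = 2 := Real.sq_sqrt (by norm_num)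
  induction m with
  | zero => simp [sqrtTwoPow]
  | succ m ih =>
    rw [pow_succ, ih, sqrtTwoPow]
    push_cast
    linear_combination (sqrtTwoPow m).2 * h2

/-- The coefficient inequality multiplied by 10000 · √2 · 4^n, which leaves only integers once √2/2
is lowered to 0.7071 and 2(2 - √2)^n is raised to 1. Binomials appear as `descFactorial` quotients
for the sake of kernel evaluation. -/
theorem choose_mul_sqrtTwoPow_le : ∀ n ∈ Finset.Icc 4 27, ∀ j ∈ Finset.Icc 1 (n / 2),
    10000 * ((2 * n).descFactorial (2 * j) / (2 * j).factorial) * 2 ^ j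
        * (2 * (sqrtTwoPow (n - 2 * j)).1) ≤
      n.descFactorial j / j.factorial * (7071 * 4 ^ n + 10000 * (2 * (sqrtTwoPow n).1 - 1)) := by
  decide +kernel

theorem profileCoeff_le_of_two_mul_le {n j : ℕ} (hn : 4 ≤ n) (hn' : n ≤ 27) (hj : 1 ≤ j)
    (hjn : 2 * j ≤ n) : profileCoeff n j ≤ (1 / 2 + lam (2 * n)) * n.choose j := by
  have hnat := choose_mul_sqrtTwoPow_le n (by simp; omega) j (by simp; omega)
  rw [← Nat.choose_eq_descFactorial_div_factorial, ← Nat.choose_eq_descFactorial_div_factorial]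
    at hnat
  have hu1 : 1 ≤ (sqrtTwoPow n).1 := by
    clear hnat hjn hn' hn
    induction n with
    | zero => simp [sqrtTwoPow]
    | succ n ih => simp only [sqrtTwoPow]; omega
  have hreal : (10000 : ℝ) * (2 * n).choose (2 * j) * 2 ^ j * (2 * (sqrtTwoPow (n - 2 * j)).1) ≤
      n.choose j * (7071 * 4 ^ n + 10000 * (2 * (sqrtTwoPow n).1 - 1)) := by
    have : (((2 * (sqrtTwoPow n).1 - 1 : ℕ) : ℕ) : ℝ) = 2 * (sqrtTwoPow n).1 - 1 := by
      rw [Nat.cast_sub (by omega)]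
      push_cast
      ring
    rw [← this]
    exact_mod_cast hnat
  have hs : √2 ^ 2 = 2 := Real.sq_sqrt (by norm_num)
  have hs0 : 0 < √2 := by positivity
  have hs1 : 1.4142 ≤ √2 := Real.le_sqrt_of_sq_le (by norm_num)
  have hm := two_add_sqrt_two_pow (n - 2 * j)
  have hm' := two_sub_sqrt_two_pow (n - 2 * j)
  have hn2 := two_add_sqrt_two_pow n
  have hn2' := two_sub_sqrt_two_pow n
  have hsmall : (2 - √2) ^ n ≤ 1 / 2 := by
    have hs2 : √2 ≤ 2 := Real.sqrt_le_iff.2 ⟨by norm_num, by norm_num⟩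
    calc (2 - √2) ^ n ≤ (2 - √2) ^ 4 :=
          pow_le_pow_of_le_one (by linarith) (by linarith) hn
      _ ≤ 0.6 ^ 4 := pow_le_pow_left₀ (by linarith) (by linarith) 4
      _ ≤ 1 / 2 := by norm_num
  have hcoef : √2 * 4 ^ n * profileCoeff n j
      = (2 * n).choose (2 * j) * 2 ^ j * (2 * (sqrtTwoPow (n - 2 * j)).1) := by
    have e1 : (𝖼 ^ 2) ^ (n - j) * (𝗌 ^ 2) ^ j + (𝗌 ^ 2) ^ (n - j) * (𝖼 ^ 2) ^ j
        = 2 ^ j * (2 * (sqrtTwoPow (n - 2 * j)).1) / 4 ^ n := by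
      have e2 : (2 * ((sqrtTwoPow (n - 2 * j)).1 : ℝ)) = (2 + √2) ^ (n - 2 * j) + (2 - √2) ^ (n - 2 * j) := by
        rw [hm, hm']; ring
      have e3 : (2 : ℝ) ^ j = (2 + √2) ^ j * (2 - √2) ^ j := by
        rw [← mul_pow]
        congr 1
        linear_combination hs
      have e4 : (4 : ℝ) ^ n = 4 ^ (n - j) * 4 ^ j := by rw [← pow_add]; congr 1; omega
      have e5 : n - j = (n - 2 * j) + j := by omega
      rw [e2, e3, e4, cos_sq_pi_div_eight, sin_sq_pi_div_eight, e5]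
      simp only [div_pow, pow_add]
      field_simp
    have h0 : j ≠ 0 := by omega
    have h1 : j ≠ n := by omega
    unfold profileCoeff
    rw [e1]
    simp only [h0, h1, if_false]
    field_simp
    ring
  have hlam : √2 * 4 ^ n * (1 / 2 + lam (2 * n))
      = √2 / 2 * 4 ^ n + (2 * (sqrtTwoPow n).1 - 2 * (2 - √2) ^ n) := by
    have : (2 * ((sqrtTwoPow n).1 : ℝ)) = (2 + √2) ^ n + (2 - √2) ^ n := by
      rw [hn2, hn2']; ring
    unfold lam
    rw [this, pow_mul, pow_mul, cos_sq_pi_div_eight, sin_sq_pi_div_eight, div_pow, div_pow]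
    field_simp
    ring
  have hpos : 0 < √2 * 4 ^ n := by positivity
  refine le_of_mul_le_mul_left ?_ hpos
  rw [hcoef, ← mul_assoc (√2 * 4 ^ n), hlam]
  have h4 : (0 : ℝ) < 4 ^ n := by positivity
  have hc : (0 : ℝ) ≤ n.choose j := by positivity
  have : (n.choose j : ℝ) * (7071 * 4 ^ n + 10000 * (2 * (sqrtTwoPow n).1 - 1))
      ≤ n.choose j * (10000 * (√2 / 2 * 4 ^ n + (2 * (sqrtTwoPow n).1 - 2 * (2 - √2) ^ n))) := by
    refine mul_le_mul_of_nonneg_left ?_ hc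
    nlinarith
  linarith

theorem profileCoeff_le {n j : ℕ} (hn : 4 ≤ n) (hn' : n ≤ 27) (hj : j ≤ n) :
    profileCoeff n j ≤ (1 / 2 + lam (2 * n)) * n.choose j := by
  have key : ∀ j, 2 * j ≤ n → profileCoeff n j ≤ (1 / 2 + lam (2 * n)) * n.choose j := by
    intro j hj
    rcases Nat.eq_zero_or_pos j with rfl | h
    · simp [profileCoeff_zero (show n ≠ 0 by omega)]
    · exact profileCoeff_le_of_two_mul_le hn hn' h hj
  rcases le_total (2 * j) n with h | h
  · exact key j h
  · rw [← profileCoeff_symm hj, ← Nat.choose_symm hj]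
    exact key _ (by omega)

theorem profile_le_of_le {n : ℕ} (hn : 4 ≤ n) (hn' : n ≤ 27) {p q : ℝ} (h : p ^ 2 + q ^ 2 = 1) :
    profile n p q ≤ 1 / 2 + lam (2 * n) := by
  have h1 : (p ^ 2 + q ^ 2) ^ n = 1 := by rw [h, one_pow]
  rw [add_comm, add_pow] at h1
  rw [profile_eq_sum]
  refine le_of_le_of_eq ?_ ((congrArg ((1 / 2 + lam (2 * n)) * ·) h1).trans (mul_one _))
  rw [mul_sum]
  refine sum_le_sum fun j hj => ?_
  have hj' : j ≤ n := by simpa [Nat.lt_succ_iff] using hj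
  calc profileCoeff n j * ((p ^ 2) ^ (n - j) * (q ^ 2) ^ j)
      ≤ (1 / 2 + lam (2 * n)) * n.choose j * ((p ^ 2) ^ (n - j) * (q ^ 2) ^ j) :=
        mul_le_mul_of_nonneg_right (profileCoeff_le hn hn' hj') (by positivity)
    _ = _ := by ring

/-! ### Analytic comparison for n ≥ 28. -/

theorem ghzWeight_nonneg {N : ℕ} (hN : 4 ≤ N) : 0 ≤ ghzWeight N := by
  have hs1 : 1.4142 ≤ √2 := Real.le_sqrt_of_sq_le (by norm_num)
  have hs2 : √2 ≤ 1.4143 := Real.sqrt_le_iff.2 ⟨by norm_num, by norm_num⟩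
  have h : 𝗌 ^ N ≤ 1 / 4 := by
    calc 𝗌 ^ N ≤ 𝗌 ^ 2 := pow_le_pow_of_le_one sin_pi_div_eight_pos.le (Real.sin_le_one _) (by omega)
      _ ≤ 1 / 4 := by rw [sin_sq_pi_div_eight]; linarith
  have h0 : 0 ≤ 𝗌 ^ N := pow_nonneg sin_pi_div_eight_pos.le _
  unfold ghzWeight
  nlinarith

theorem ghzWeight_le (N : ℕ) : ghzWeight N ≤ 1 / 2 := by
  have h0 : 0 ≤ √2 * 𝗌 ^ N := mul_nonneg (by positivity) (pow_nonneg sin_pi_div_eight_pos.le _)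
  unfold ghzWeight
  linarith

theorem profileCoeff_nonneg {n : ℕ} (hn : 4 ≤ n) (j : ℕ) : 0 ≤ profileCoeff n j := by
  have := ghzWeight_nonneg (show 4 ≤ 2 * n by omega)
  unfold profileCoeff
  positivity

/-- A bound that is crude in all terms but `(𝖼 + 𝗌 r) ^ (2 n)`. -/
theorem profile_one_le {n : ℕ} (hn : 28 ≤ n) {r B : ℝ} (hr0 : 0 ≤ r) (hr1 : r ≤ 1)
    (hB : (𝖼 + 𝗌 * r) ^ 2 ≤ B * (1 + r ^ 2)) :
    profile n 1 r ≤ 1 / 2 + (0.3536 * (B ^ n + 0.0241) + 0.0001) * (1 + r ^ 2) ^ n := by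
  have hs1 : 1.4142 ≤ √2 := Real.le_sqrt_of_sq_le (by norm_num)
  have hs2 : √2 ≤ 1.4143 := Real.sqrt_le_iff.2 ⟨by norm_num, by norm_num⟩
  have hc2 := cos_sq_pi_div_eight
  have hsi2 := sin_sq_pi_div_eight
  have hcs := two_mul_cos_mul_sin_pi_div_eight
  have hy : 0 < (1 + r ^ 2) ^ n := by positivity
  -- The three minor powers contribute 0.012 + 0.012 + 0.0001 = 0.0241; the final 0.0001 absorbs
  -- r^(2n).
  have hC : (𝖼 ^ 2) ^ n ≤ 0.012 := by
    calc (𝖼 ^ 2) ^ n ≤ (𝖼 ^ 2) ^ 28 :=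
          pow_le_pow_of_le_one (by positivity) (by rw [hc2]; linarith) hn
      _ ≤ 0.8536 ^ 28 := pow_le_pow_left₀ (by positivity) (by rw [hc2]; linarith) 28
      _ ≤ 0.012 := by norm_num
  have hpow : ∀ a : ℝ, a ^ 2 ≤ 𝖼 ^ 2 * (1 + r ^ 2) → a ^ (2 * n) ≤ 0.012 * (1 + r ^ 2) ^ n := by
    intro a ha
    calc a ^ (2 * n) = (a ^ 2) ^ n := pow_mul _ _ _
      _ ≤ (𝖼 ^ 2 * (1 + r ^ 2)) ^ n := pow_le_pow_left₀ (by positivity) ha n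
      _ = (𝖼 ^ 2) ^ n * (1 + r ^ 2) ^ n := mul_pow _ _ _
      _ ≤ _ := mul_le_mul_of_nonneg_right hC hy.le
  have hr2 : r ^ 2 ≤ 1 := pow_le_one₀ hr0 hr1
  have hrr : r ^ 2 ≤ r := by nlinarith
  have b1 : (𝖼 * 1 + 𝗌 * r) ^ (2 * n) ≤ B ^ n * (1 + r ^ 2) ^ n := by
    rw [pow_mul, ← mul_pow, mul_one]
    exact pow_le_pow_left₀ (by positivity) hB n
  have b2 := hpow (𝖼 * 1 - 𝗌 * r) (by nlinarith)
  have b3 := hpow (𝗌 * 1 + 𝖼 * r) (by nlinarith)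
  have b4 : (𝗌 * 1 - 𝖼 * r) ^ (2 * n) ≤ 0.0001 * (1 + r ^ 2) ^ n := by
    have h3 : (𝗌 * 1 - 𝖼 * r) ^ 2 ≤ 0.3 * (1 + r ^ 2) := by nlinarith
    calc (𝗌 * 1 - 𝖼 * r) ^ (2 * n) = ((𝗌 * 1 - 𝖼 * r) ^ 2) ^ n := pow_mul _ _ _
      _ ≤ (0.3 * (1 + r ^ 2)) ^ n := pow_le_pow_left₀ (by positivity) h3 n
      _ = 0.3 ^ n * (1 + r ^ 2) ^ n := mul_pow _ _ _
      _ ≤ _ := by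
        refine mul_le_mul_of_nonneg_right ?_ hy.le
        calc (0.3 : ℝ) ^ n ≤ 0.3 ^ 28 := pow_le_pow_of_le_one (by norm_num) (by norm_num) hn
          _ ≤ _ := by norm_num
  have b5 : r ^ (2 * n) ≤ 0.0001 * (1 + r ^ 2) ^ n := by
    calc r ^ (2 * n) = (r ^ 2) ^ n := pow_mul _ _ _
      _ ≤ (1 / 2 * (1 + r ^ 2)) ^ n := pow_le_pow_left₀ (by positivity) (by linarith) n
      _ = (1 / 2) ^ n * (1 + r ^ 2) ^ n := mul_pow _ _ _
      _ ≤ _ := by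
        refine mul_le_mul_of_nonneg_right ?_ hy.le
        calc (1 / 2 : ℝ) ^ n ≤ (1 / 2) ^ 28 := pow_le_pow_of_le_one (by norm_num) (by norm_num) hn
          _ ≤ _ := by norm_num
  have hk : ghzWeight (2 * n) * (1 ^ (2 * n) + r ^ (2 * n)) ≤ 1 / 2 * (1 ^ (2 * n) + r ^ (2 * n)) :=
    mul_le_mul_of_nonneg_right (ghzWeight_le _) (by positivity)
  have hinv : 1 / (2 * √2) ≤ 0.3536 := by
    rw [div_le_iff₀ (by positivity)]
    linarith
  have hsum : 0 ≤ (𝖼 * 1 + 𝗌 * r) ^ (2 * n) + (𝖼 * 1 - 𝗌 * r) ^ (2 * n) +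
      (𝗌 * 1 + 𝖼 * r) ^ (2 * n) + (𝗌 * 1 - 𝖼 * r) ^ (2 * n) := by
    simp only [pow_mul]
    positivity
  have := mul_le_mul_of_nonneg_right hinv hsum
  unfold profile
  rw [one_pow] at hk ⊢
  linarith

/-- Cauchy–Schwarz allows B = 1. With y = (1 + r²)^n the crude bound is then 1/2 + 0.3623 y, which
is below y/2 once y ≥ 3.7. -/
theorem profile_one_le_of_ge {n : ℕ} (hn : 28 ≤ n) {r : ℝ} (hr0 : 0 ≤ r) (hr1 : r ≤ 1)
    (hr : 3.7 ≤ (1 + r ^ 2) ^ n) : profile n 1 r ≤ 1 / 2 * (1 + r ^ 2) ^ n := by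
  have h := profile_one_le (B := 1) hn hr0 hr1 (by
    have := Real.cos_sq_add_sin_sq (Real.pi / 8)
    nlinarith [sq_nonneg (𝖼 * r - 𝗌)])
  rw [one_pow] at h
  linarith

/-- Near r = 0 the inequality is sharp, so crude bounds fail. Instead `profile n 1 r` is a
polynomial in r² with nonnegative coefficients and constant term M = 1/2 + λ; a linear bound at the
endpoint t, where (1 + t²)^n = 3.7, passes to all smaller r, and Bernoulli's inequality finishes. -/
theorem profile_one_le_of_le {n : ℕ} (hn : 28 ≤ n) {r : ℝ}
    (hr : (1 + r ^ 2) ^ n ≤ 3.7) :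
    profile n 1 r ≤ (1 / 2 + lam (2 * n)) * (1 + r ^ 2) ^ n := by
  obtain ⟨t, ht0, ht⟩ : ∃ t : ℝ, 0 < t ∧ (1 + t ^ 2) ^ n = 3.7 := by
    have h1 : (1 : ℝ) < (3.7 : ℝ) ^ ((n : ℝ)⁻¹) :=
      Real.one_lt_rpow (by norm_num) (by have : (0 : ℝ) < n := by exact_mod_cast (by omega)
                                         positivity)
    refine ⟨√((3.7 : ℝ) ^ ((n : ℝ)⁻¹) - 1), Real.sqrt_pos.2 (by linarith), ?_⟩
    rw [Real.sq_sqrt (by linarith), add_sub_cancel]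
    exact Real.rpow_inv_natCast_pow (by norm_num) (by omega)
  have ht1 : t ^ 2 ≤ 0.048 := by
    by_contra! hlt
    have : (3.7 : ℝ) < (1 + t ^ 2) ^ n := by
      calc (3.7 : ℝ) < 1.048 ^ 28 := by norm_num
        _ ≤ (1 + t ^ 2) ^ 28 := pow_le_pow_left₀ (by norm_num) (by linarith) 28
        _ ≤ _ := pow_le_pow_right₀ (by nlinarith) hn
    linarith
  have ht2 : t ≤ 0.2191 := by
    by_contra! hlt
    nlinarith
  -- Since e^{1.3} < 3.7 = (1 + t²)^n ≤ e^{n t²}; tenth powers reduce the numerical claim to a bound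
  -- on e^{13}.
  have hnt : 1.3 ≤ n * t ^ 2 := by
    by_contra! hlt
    have h1 : (3.7 : ℝ) ≤ Real.exp (n * t ^ 2) := by
      rw [← ht, Real.exp_nat_mul]
      exact pow_le_pow_left₀ (by positivity) (by linarith [Real.add_one_le_exp (t ^ 2)]) n
    have h2 : Real.exp 1.3 ^ 10 < 3.7 ^ 10 := by
      rw [← Real.exp_nat_mul, show ((10 : ℕ) : ℝ) * 1.3 = (13 : ℕ) * 1 by norm_num, Real.exp_nat_mul]
      calc Real.exp 1 ^ 13 ≤ 2.7182818286 ^ 13 :=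
            pow_le_pow_left₀ (Real.exp_pos _).le Real.exp_one_lt_d9.le 13
        _ < _ := by norm_num
    have h3 := lt_of_pow_lt_pow_left₀ 10 (by norm_num) h2
    have h4 := Real.exp_lt_exp.2 hlt
    linarith
  have hs1 : 1.4142 ≤ √2 := Real.le_sqrt_of_sq_le (by norm_num)
  have hs2 : √2 ≤ 1.4143 := Real.sqrt_le_iff.2 ⟨by norm_num, by norm_num⟩
  -- As t ≤ 0.2191 stays well below 𝗌/𝖼, B = 0.97 is admissible; the left side is then under 1.1 and
  -- the right side at least 1.15.
  have hΦt : profile n 1 t ≤ 1 / 2 * (1 + n * t ^ 2) := by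
    have h := profile_one_le (B := 0.97) hn ht0.le (by linarith) (by
      have hc2 := cos_sq_pi_div_eight
      have hsi2 := sin_sq_pi_div_eight
      have hcs := two_mul_cos_mul_sin_pi_div_eight
      have : (𝖼 + 𝗌 * t) ^ 2 = (2 + √2) / 4 + √2 / 2 * t + (2 - √2) / 4 * t ^ 2 := by
        rw [← hc2, ← hsi2, ← hcs]; ring
      rw [this]
      nlinarith)
    have hB : (0.97 : ℝ) ^ n ≤ 0.4263 :=
      calc (0.97 : ℝ) ^ n ≤ 0.97 ^ 28 := pow_le_pow_of_le_one (by norm_num) (by norm_num) hn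
        _ ≤ _ := by norm_num
    rw [ht] at h
    linarith
  set M := 1 / 2 + lam (2 * n) with hM
  have hM0 : 1 / 2 ≤ M := by linarith [lam_nonneg (2 * n)]
  have hrt : r ^ 2 ≤ t ^ 2 := by
    by_contra! hlt
    have := pow_lt_pow_left₀ (show 1 + t ^ 2 < 1 + r ^ 2 by linarith) (by positivity)
      (show n ≠ 0 by omega)
    linarith
  have hsplit : ∀ x : ℝ, profile n 1 x
      = M + ∑ j ∈ range n, profileCoeff n (j + 1) * (x ^ 2) ^ (j + 1) := by
    intro x
    rw [profile_eq_sum, sum_range_succ', profileCoeff_zero (by omega), ← hM]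
    simp only [one_pow, one_mul, pow_zero, mul_one]
    ring
  -- A polynomial in x with nonnegative coefficients and no constant term, divided by x, is
  -- nondecreasing; here x = r² ≤ t².
  have hchord : t ^ 2 * ∑ j ∈ range n, profileCoeff n (j + 1) * (r ^ 2) ^ (j + 1)
      ≤ r ^ 2 * ∑ j ∈ range n, profileCoeff n (j + 1) * (t ^ 2) ^ (j + 1) := by
    rw [mul_sum, mul_sum]
    refine sum_le_sum fun j _ => ?_
    have h1 : (r ^ 2) ^ j ≤ (t ^ 2) ^ j := pow_le_pow_left₀ (by positivity) hrt j
    have h2 : 0 ≤ profileCoeff n (j + 1) * t ^ 2 * r ^ 2 := by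
      have := profileCoeff_nonneg (show 4 ≤ n by omega) (j + 1)
      positivity
    have := mul_le_mul_of_nonneg_left h1 h2
    calc t ^ 2 * (profileCoeff n (j + 1) * (r ^ 2) ^ (j + 1))
        = profileCoeff n (j + 1) * t ^ 2 * r ^ 2 * (r ^ 2) ^ j := by ring
      _ ≤ _ := this
      _ = _ := by ring
  have h1 := hsplit t
  have h2 := hsplit r
  have ht2' : 0 < t ^ 2 := by positivity
  have h3 : ∑ j ∈ range n, profileCoeff n (j + 1) * (r ^ 2) ^ (j + 1) ≤ M * (n * r ^ 2) := by
    refine le_of_mul_le_mul_left (hchord.trans ?_) ht2'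
    have : ∑ j ∈ range n, profileCoeff n (j + 1) * (t ^ 2) ^ (j + 1) ≤ M * (n * t ^ 2) := by
      nlinarith
    calc _ ≤ r ^ 2 * (M * (n * t ^ 2)) := mul_le_mul_of_nonneg_left this (by positivity)
      _ = _ := by ring
  have h4 := one_add_mul_le_pow (show (-2 : ℝ) ≤ r ^ 2 by nlinarith) n
  rw [h2]
  nlinarith

theorem profile_swap (n : ℕ) (p q : ℝ) : profile n q p = profile n p q := by
  have h1 : (𝖼 * q - 𝗌 * p) ^ (2 * n) = (𝗌 * p - 𝖼 * q) ^ (2 * n) := by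
    rw [pow_mul, pow_mul]; congr 1; ring
  have h2 : (𝗌 * q - 𝖼 * p) ^ (2 * n) = (𝖼 * p - 𝗌 * q) ^ (2 * n) := by
    rw [pow_mul, pow_mul]; congr 1; ring
  unfold profile
  rw [h1, h2]
  ring

theorem profile_le {n : ℕ} (hn : 4 ≤ n) {p q : ℝ} (hp : 0 ≤ p) (hq : 0 ≤ q)
    (h : p ^ 2 + q ^ 2 = 1) : profile n p q ≤ 1 / 2 + lam (2 * n) := by
  rcases Nat.lt_or_ge n 28 with h28 | h28
  · exact profile_le_of_le hn (by omega) h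
  wlog hqp : q ≤ p generalizing p q
  · rw [← profile_swap]
    exact this hq hp (by linarith) (by linarith)
  have hp0 : 0 < p := by
    rcases hp.lt_or_eq with h0 | h0
    · exact h0
    · rw [← h0] at hqp h
      rw [le_antisymm hqp hq] at h
      norm_num at h
  have hr : q / p ≤ 1 := (div_le_one hp0).2 hqp
  have hr0 : 0 ≤ q / p := by positivity
  have hone : p ^ (2 * n) * (1 + (q / p) ^ 2) ^ n = 1 := by
    rw [pow_mul, ← mul_pow, mul_add, mul_one, ← mul_pow, mul_div_cancel₀ _ hp0.ne', h, one_pow]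
  have hhom : profile n p q = p ^ (2 * n) * profile n 1 (q / p) := by
    have hq' : q = p * (q / p) := (mul_div_cancel₀ _ hp0.ne').symm
    generalize q / p = r at hq'
    subst hq'
    unfold profile
    rw [show 𝖼 * p + 𝗌 * (p * r) = p * (𝖼 * 1 + 𝗌 * r) by ring,
      show 𝖼 * p - 𝗌 * (p * r) = p * (𝖼 * 1 - 𝗌 * r) by ring,
      show 𝗌 * p + 𝖼 * (p * r) = p * (𝗌 * 1 + 𝖼 * r) by ring,
      show 𝗌 * p - 𝖼 * (p * r) = p * (𝗌 * 1 - 𝖼 * r) by ring]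
    simp only [mul_pow, one_pow]
    ring
  have hb : profile n 1 (q / p) ≤ (1 / 2 + lam (2 * n)) * (1 + (q / p) ^ 2) ^ n := by
    rcases le_total (3.7 : ℝ) ((1 + (q / p) ^ 2) ^ n) with h3 | h3
    · refine (profile_one_le_of_ge h28 hr0 hr h3).trans ?_
      have := lam_nonneg (2 * n)
      gcongr
      linarith
    · exact profile_one_le_of_le h28 h3
  rw [hhom]
  calc _ ≤ p ^ (2 * n) * ((1 / 2 + lam (2 * n)) * (1 + (q / p) ^ 2) ^ n) :=
        mul_le_mul_of_nonneg_left hb (by positivity)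
    _ = (1 / 2 + lam (2 * n)) * (p ^ (2 * n) * (1 + (q / p) ^ 2) ^ n) := by ring
    _ = _ := by rw [hone, mul_one]

/-! ### The odd form. -/

/-- The profile of the odd part is dominated by that of the even part. -/
theorem oddProfile_le {n : ℕ} (hn : 4 ≤ n) {p q : ℝ} (hp : 0 ≤ p) (hq : 0 ≤ q)
    (h : p ^ 2 + q ^ 2 = 1) :
    1 / 2 * (p ^ (2 * n) + q ^ (2 * n)) +
      1 / (2 * √2) * ((𝖼 * p + 𝗌 * q) ^ (2 * n) - (𝖼 * p - 𝗌 * q) ^ (2 * n) +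
        (𝗌 * p + 𝖼 * q) ^ (2 * n) - (𝗌 * p - 𝖼 * q) ^ (2 * n)) ≤ 1 / 2 + lam (2 * n) := by
  have hs0 := sin_pi_div_eight_pos
  have hc := cos_eq_sin_add_pi_div_eight
  have hs : √2 ^ 2 = 2 := Real.sq_sqrt (by norm_num)
  -- Because 𝖼 - 𝗌 = √2 𝗌, one has 𝖼p - 𝗌q ≥ √2 𝗌p, and the factor √2^(2n) = 2^n ≥ 4 leaves enough
  -- room.
  have key : ∀ p q : ℝ, 0 ≤ p → 0 ≤ q → q ≤ p →
      2 * 𝗌 ^ (2 * n) * (p ^ (2 * n) + q ^ (2 * n)) ≤ (𝖼 * p - 𝗌 * q) ^ (2 * n) := by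
    intro p q hp hq hqp
    have h1 : √2 * 𝗌 * p ≤ 𝖼 * p - 𝗌 * q := by
      rw [hc]
      nlinarith
    have h2 : (√2 * 𝗌 * p) ^ (2 * n) ≤ (𝖼 * p - 𝗌 * q) ^ (2 * n) :=
      pow_le_pow_left₀ (by positivity) h1 _
    have h3 : q ^ (2 * n) ≤ p ^ (2 * n) := pow_le_pow_left₀ hq hqp _
    have h4 : (4 : ℝ) ≤ 2 ^ n :=
      calc (4 : ℝ) = 2 ^ 2 := by norm_num
        _ ≤ 2 ^ n := pow_le_pow_right₀ (by norm_num) (by omega)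
    have h5 : (√2 * 𝗌 * p) ^ (2 * n) = 2 ^ n * (𝗌 ^ (2 * n) * p ^ (2 * n)) := by
      rw [mul_pow, mul_pow, pow_mul √2, hs, mul_assoc]
    have h6 : 0 ≤ 𝗌 ^ (2 * n) := by positivity
    have h7 : 0 ≤ p ^ (2 * n) := by positivity
    have h8 := mul_le_mul_of_nonneg_right h4 (mul_nonneg h6 h7)
    have h9 := mul_le_mul_of_nonneg_left h3 h6
    linarith
  have key2 : 2 * 𝗌 ^ (2 * n) * (p ^ (2 * n) + q ^ (2 * n))
      ≤ (𝖼 * p - 𝗌 * q) ^ (2 * n) + (𝗌 * p - 𝖼 * q) ^ (2 * n) := by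
    have e : (𝗌 * p - 𝖼 * q) ^ (2 * n) = (𝖼 * q - 𝗌 * p) ^ (2 * n) := by
      rw [pow_mul, pow_mul]; congr 1; ring
    have n1 : 0 ≤ (𝖼 * p - 𝗌 * q) ^ (2 * n) := by rw [pow_mul]; positivity
    have n2 : 0 ≤ (𝗌 * p - 𝖼 * q) ^ (2 * n) := by rw [pow_mul]; positivity
    rcases le_total q p with hqp | hqp
    · linarith [key p q hp hq hqp]
    · linarith [key q p hq hp hqp]
  refine le_trans ?_ (profile_le hn hp hq h)
  unfold profile ghzWeight
  have e1 : √2 * 𝗌 ^ (2 * n) = 1 / (2 * √2) * (4 * 𝗌 ^ (2 * n)) := by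
    field_simp
    linear_combination 2 * hs
  have h0 : 0 ≤ 1 / (2 * √2) := by positivity
  have := mul_le_mul_of_nonneg_left key2 h0
  rw [e1]
  linarith

/-! ### Symmetrisation of nonnegative product vectors. -/

/-- The tuples of unit vectors of the closed first quadrant. -/
def quadrantUnitVectors (ι : Type*) : Set (ι → Fin 2 → ℝ) :=
  {φ | ∀ i, (∀ b, 0 ≤ φ i b) ∧ φ i 0 ^ 2 + φ i 1 ^ 2 = 1}

theorem isCompact_quadrantUnitVectors {ι : Type*} : IsCompact (quadrantUnitVectors ι) := by
  have hsub : quadrantUnitVectors ι ⊆ Set.Icc 0 1 := by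
    intro φ hφ
    refine ⟨fun i b => (hφ i).1 b, fun i b => ?_⟩
    have h := (hφ i).2
    have h0 := (hφ i).1 b
    have : φ i b ^ 2 ≤ 1 := by
      fin_cases b
      · simp only [Fin.zero_eta]; nlinarith [sq_nonneg (φ i 1)]
      · simp only [Fin.mk_one]; nlinarith [sq_nonneg (φ i 0)]
    simpa using (sq_le_one_iff₀ h0).1 this
  refine IsCompact.of_isClosed_subset isCompact_Icc ?_ hsub
  have : quadrantUnitVectors ι
      = ⋂ i, {φ | (∀ b, 0 ≤ φ i b) ∧ φ i 0 ^ 2 + φ i 1 ^ 2 = 1} := by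
    ext φ; simp [quadrantUnitVectors]
  rw [this]
  refine isClosed_iInter fun i => IsClosed.inter ?_ ?_
  · have : {φ : ι → Fin 2 → ℝ | ∀ b, 0 ≤ φ i b} = ⋂ b, {φ | 0 ≤ φ i b} := by ext; simp
    change IsClosed {φ : ι → Fin 2 → ℝ | ∀ b, 0 ≤ φ i b}
    rw [this]
    exact isClosed_iInter fun b => isClosed_le continuous_const (by fun_prop)
  · exact isClosed_eq (by fun_prop) continuous_const

section Smoothing

variable {ι : Type*} [Fintype ι] [DecidableEq ι]

theorem prod_eq_mul_mul_prod_erase {i j : ι} (hij : i ≠ j) (f : ι → ℝ) :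
    ∏ l, f l = f i * f j * ∏ l ∈ (univ.erase i).erase j, f l := by
  rw [mul_assoc, mul_prod_erase _ _ (by simp [hij.symm]), mul_prod_erase _ _ (mem_univ i)]

theorem sum_eq_add_add_sum_erase {i j : ι} (hij : i ≠ j) (f : ι → ℝ) :
    ∑ l, f l = f i + f j + ∑ l ∈ (univ.erase i).erase j, f l := by
  rw [add_assoc, add_sum_erase _ _ (by simp [hij.symm]), add_sum_erase _ _ (mem_univ i)]

/-- Cauchy–Schwarz for (a, x) and (y, b) after reordering: the gap between the squares is (ab -
xy)². -/
theorem mul_add_mul_le_two_mul_sqrt (a b x y : ℝ) :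
    a * y + b * x ≤ 2 * (√((a ^ 2 + x ^ 2) / 2) * √((b ^ 2 + y ^ 2) / 2)) := by
  refine le_of_sq_le_sq ?_ (by positivity)
  rw [mul_pow, mul_pow, Real.sq_sqrt (by positivity), Real.sq_sqrt (by positivity)]
  nlinarith [sq_nonneg (a * b - x * y)]

/-- Replacing two of the vectors by their quadratic mean increases the value of a symmetric
nonnegative tensor. -/
theorem sum_mul_prod_le_of_average {D : (ι → Fin 2) → ℝ} (hD : ∀ z, 0 ≤ D z)
    (hsymm : ∀ (σ : Equiv.Perm ι) z, D (z ∘ σ) = D z) {φ : ι → Fin 2 → ℝ}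
    (hφ : ∀ i b, 0 ≤ φ i b) {i j : ι} (hij : i ≠ j) :
    ∑ z, D z * ∏ l, φ l (z l) ≤ ∑ z, D z * ∏ l,
      (if l = i ∨ l = j then fun b => √((φ i b ^ 2 + φ j b ^ 2) / 2) else φ l) (z l) := by
  set ψ : ι → Fin 2 → ℝ :=
    fun l => if l = i ∨ l = j then fun b => √((φ i b ^ 2 + φ j b ^ 2) / 2) else φ l with hψ
  have hswap : ∑ z, D z * ∏ l, φ l (z l) = ∑ z, D z * ∏ l, φ l (z (Equiv.swap i j l)) := by
    rw [← (Equiv.arrowCongr (Equiv.swap i j) (Equiv.refl (Fin 2))).sum_comp]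
    refine sum_congr rfl fun z _ => ?_
    have : (Equiv.arrowCongr (Equiv.swap i j) (Equiv.refl (Fin 2))) z = z ∘ Equiv.swap i j := by
      ext l; simp [Equiv.arrowCongr]
    rw [this, hsymm]
    rfl
  have hle : ∑ z, D z * ∏ l, φ l (z l) + ∑ z, D z * ∏ l, φ l (z (Equiv.swap i j l))
      ≤ 2 * ∑ z, D z * ∏ l, ψ l (z l) := by
    rw [← sum_add_distrib, mul_sum]
    refine sum_le_sum fun z _ => ?_
    rw [prod_eq_mul_mul_prod_erase hij, prod_eq_mul_mul_prod_erase hij (fun l => φ l (z (Equiv.swap i j l))),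
      prod_eq_mul_mul_prod_erase hij (fun l => ψ l (z l))]
    have h1 : ∏ l ∈ (univ.erase i).erase j, φ l (z (Equiv.swap i j l))
        = ∏ l ∈ (univ.erase i).erase j, φ l (z l) := by
      refine prod_congr rfl fun l hl => ?_
      simp only [mem_erase, mem_univ, and_true] at hl
      rw [Equiv.swap_apply_of_ne_of_ne hl.2 hl.1]
    have h2 : ∏ l ∈ (univ.erase i).erase j, ψ l (z l)
        = ∏ l ∈ (univ.erase i).erase j, φ l (z l) := by
      refine prod_congr rfl fun l hl => ?_
      simp only [mem_erase, mem_univ, and_true] at hl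
      simp [hψ, hl.1, hl.2]
    have h3 : 0 ≤ ∏ l ∈ (univ.erase i).erase j, φ l (z l) := prod_nonneg fun l _ => hφ l _
    rw [h1, h2, Equiv.swap_apply_left, Equiv.swap_apply_right]
    have h4 : ψ i (z i) = √((φ i (z i) ^ 2 + φ j (z i) ^ 2) / 2) := by simp [hψ]
    have h5 : ψ j (z j) = √((φ i (z j) ^ 2 + φ j (z j) ^ 2) / 2) := by simp [hψ]
    rw [h4, h5]
    have h6 := mul_add_mul_le_two_mul_sqrt (φ i (z i)) (φ i (z j)) (φ j (z i)) (φ j (z j))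
    have := mul_le_mul_of_nonneg_left h6 (mul_nonneg (hD z) h3)
    linarith
  rw [← hswap] at hle
  linarith

/-- A symmetric tensor with nonnegative coefficients attains its maximum over nonnegative product
vectors at a symmetric product vector. -/
theorem sum_mul_prod_le_of_symmetric [Nonempty ι] {D : (ι → Fin 2) → ℝ} (hD : ∀ z, 0 ≤ D z)
    (hsymm : ∀ (σ : Equiv.Perm ι) z, D (z ∘ σ) = D z) {M : ℝ}
    (hM : ∀ v : Fin 2 → ℝ, (∀ b, 0 ≤ v b) → v 0 ^ 2 + v 1 ^ 2 = 1 → ∑ z, D z * ∏ i, v (z i) ≤ M)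
    {φ : ι → Fin 2 → ℝ} (hφ : φ ∈ quadrantUnitVectors ι) : ∑ z, D z * ∏ i, φ i (z i) ≤ M := by
  have hcont : Continuous fun φ : ι → Fin 2 → ℝ => ∑ z, D z * ∏ i, φ i (z i) := by fun_prop
  obtain ⟨φ₀, hφ₀, hmax⟩ :=
    isCompact_quadrantUnitVectors.exists_isMaxOn ⟨φ, hφ⟩ hcont.continuousOn
  have hcomp : IsCompact (quadrantUnitVectors ι ∩ {φ | ∑ z, D z * ∏ i, φ₀ i (z i)
      ≤ ∑ z, D z * ∏ i, φ i (z i)}) :=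
    isCompact_quadrantUnitVectors.inter_right (isClosed_le continuous_const hcont)
  -- Among the maximisers, minimise a strictly convex function of the squared second coordinates.
  -- Averaging two unequal vectors stays among the maximisers and strictly lowers it, so all vectors
  -- coincide.
  obtain ⟨φ₁, ⟨hφ₁, hφ₁'⟩, hmin⟩ := hcomp.exists_isMinOn ⟨φ₀, hφ₀, le_refl (∑ z, D z * ∏ i, φ₀ i (z i))⟩
    (f := fun φ => ∑ i, (φ i 1 ^ 2) ^ 2) (by fun_prop)
  have hconst : ∀ i j, φ₁ i 1 ^ 2 = φ₁ j 1 ^ 2 := by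
    intro i j
    by_contra hne
    have hij : i ≠ j := fun h => hne (by rw [h])
    have havg := sum_mul_prod_le_of_average hD hsymm (fun i b => (hφ₁ i).1 b) hij
    set ψ : ι → Fin 2 → ℝ :=
      fun l => if l = i ∨ l = j then fun b => √((φ₁ i b ^ 2 + φ₁ j b ^ 2) / 2) else φ₁ l with hψ
    have hψmem : ψ ∈ quadrantUnitVectors ι := by
      intro l
      by_cases hl : l = i ∨ l = j
      · simp only [hψ, hl, if_true]
        refine ⟨fun b => Real.sqrt_nonneg _, ?_⟩
        rw [Real.sq_sqrt (by positivity), Real.sq_sqrt (by positivity)]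
        linarith [(hφ₁ i).2, (hφ₁ j).2]
      · simp only [hψ, hl, if_false]
        exact hφ₁ l
    have h1 : ∑ l, (φ₁ l 1 ^ 2) ^ 2 ≤ ∑ l, (ψ l 1 ^ 2) ^ 2 :=
      hmin ⟨hψmem, le_trans hφ₁' havg⟩
    rw [sum_eq_add_add_sum_erase hij, sum_eq_add_add_sum_erase hij (fun l => (ψ l 1 ^ 2) ^ 2)] at h1
    have h2 : ∑ l ∈ (univ.erase i).erase j, (ψ l 1 ^ 2) ^ 2
        = ∑ l ∈ (univ.erase i).erase j, (φ₁ l 1 ^ 2) ^ 2 := by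
      refine sum_congr rfl fun l hl => ?_
      simp only [mem_erase, mem_univ, and_true] at hl
      simp [hψ, hl.1, hl.2]
    have h3 : ψ i 1 ^ 2 = (φ₁ i 1 ^ 2 + φ₁ j 1 ^ 2) / 2 := by
      simp only [hψ, true_or, if_true]
      exact Real.sq_sqrt (by positivity)
    have h4 : ψ j 1 ^ 2 = (φ₁ i 1 ^ 2 + φ₁ j 1 ^ 2) / 2 := by
      simp only [hψ, or_true, if_true]
      exact Real.sq_sqrt (by positivity)
    rw [h2, h3, h4] at h1
    have h5 : 0 < (φ₁ i 1 ^ 2 - φ₁ j 1 ^ 2) ^ 2 := by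
      have := sub_ne_zero.2 hne
      positivity
    nlinarith
  obtain ⟨i₀⟩ := ‹Nonempty ι›
  have heq : ∀ i b, φ₁ i b = φ₁ i₀ b := by
    intro i b
    have h1 := hconst i i₀
    have h0 : φ₁ i 0 ^ 2 = φ₁ i₀ 0 ^ 2 := by linarith [(hφ₁ i).2, (hφ₁ i₀).2]
    fin_cases b
    · exact (pow_left_inj₀ ((hφ₁ i).1 0) ((hφ₁ i₀).1 0) two_ne_zero).1 h0
    · exact (pow_left_inj₀ ((hφ₁ i).1 1) ((hφ₁ i₀).1 1) two_ne_zero).1 h1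
  calc ∑ z, D z * ∏ i, φ i (z i) ≤ ∑ z, D z * ∏ i, φ₀ i (z i) := hmax hφ
    _ ≤ ∑ z, D z * ∏ i, φ₁ i (z i) := hφ₁'
    _ = ∑ z, D z * ∏ i, φ₁ i₀ (z i) := by simp only [heq]
    _ ≤ M := hM _ (hφ₁ i₀).1 (hφ₁ i₀).2

end Smoothing

/-! ### Hamming weight and the amplitudes of the state. -/

/-- The number of ones of a bit string. -/
def weight {N : ℕ} (x : Fin N → Fin 2) : ℕ := #{i | x i = 1}

theorem weight_le {N : ℕ} (x : Fin N → Fin 2) : weight x ≤ N := by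
  simpa [weight] using card_filter_le (univ : Finset (Fin N)) (fun i => x i = 1)

theorem card_filter_ne_one {N : ℕ} (x : Fin N → Fin 2) : #{i | ¬ x i = 1} = N - weight x := by
  have := card_filter_add_card_filter_not (s := (univ : Finset (Fin N))) (fun i => x i = 1)
  simp only [card_univ, Fintype.card_fin] at this
  unfold weight
  omega

theorem prod_vec_eq_pow {R : Type*} [CommMonoid R] {N : ℕ} (α β : R) (x : Fin N → Fin 2) :
    ∏ i, (![α, β] : Fin 2 → R) (x i) = α ^ (N - weight x) * β ^ weight x := by
  have h : ∀ i, (![α, β] : Fin 2 → R) (x i) = if x i = 1 then β else α := by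
    intro i
    generalize x i = b
    fin_cases b <;> simp
  simp only [h]
  rw [prod_ite, prod_const, prod_const, card_filter_ne_one, mul_comm]
  rfl

theorem sum_prod_mul_prod {R : Type*} [CommRing R] {N : ℕ} (m : Fin 2 → R) (a : Fin N → Fin 2 → R) :
    ∑ z : Fin N → Fin 2, (∏ i, m (z i)) * ∏ i, a i (z i) = ∏ i, (m 0 * a i 0 + m 1 * a i 1) := by
  simp only [← prod_mul_distrib]
  rw [← Fintype.piFinset_univ, ← prod_univ_sum (fun _ => univ) fun i b => m b * a i b]
  simp

theorem sum_pow_weight_mul_prod {R : Type*} [CommRing R] {N : ℕ} (a : Fin N → Fin 2 → R) (α β : R) :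
    ∑ z : Fin N → Fin 2, (α ^ (N - weight z) * β ^ weight z) * ∏ i, a i (z i)
      = ∏ i, (α * a i 0 + β * a i 1) := by
  simp only [← prod_vec_eq_pow]
  rw [sum_prod_mul_prod]
  rfl

theorem noncommProd_gate {N : ℕ} (E : Finset (Finset (Fin N))) :
    E.noncommProd gate (gate_pairwise_commute E) = Matrix.diagonal fun x : Fin N → Fin 2 =>
      ∏ e ∈ E, if ∀ i ∈ e, x i = 1 then (-1 : ℂ) else 1 := by
  classical
  induction E using Finset.induction_on with
  | empty => simp
  | insert e E he ih =>
    rw [noncommProd_insert_of_notMem _ _ _ _ he, ih, gate_eq_diagonal,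
      Matrix.diagonal_mul_diagonal]
    simp only [prod_insert he]

theorem prod_gate_powersetCard {N : ℕ} (k : ℕ) (x : Fin N → Fin 2) :
    (∏ e ∈ (univ : Finset (Fin N)).powersetCard k, if ∀ i ∈ e, x i = 1 then (-1 : ℂ) else 1)
      = (-1) ^ (weight x).choose k := by
  rw [prod_ite, prod_const, prod_const, one_pow, mul_one, weight, ← card_powersetCard]
  congr 2
  ext e
  simp only [mem_filter, mem_powersetCard, true_and, subset_iff, mem_univ]
  tauto

theorem uniformCompleteState_apply (k N : ℕ) (x : Fin N → Fin 2) :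
    uniformCompleteState k N x = (-1) ^ (weight x).choose k * (1 / (√2 : ℂ)) ^ N := by
  unfold uniformCompleteState hypergraphState
  rw [noncommProd_gate]
  simp only [Matrix.toLpLin_apply, Matrix.mulVec_diagonal, prod_gate_powersetCard]
  congr 1
  have : ∀ b, ketPlus b = 1 / (√2 : ℂ) := by
    intro b
    fin_cases b <;> simp [ketPlus]
  simp [productKet, this]

theorem neg_one_pow_choose_five (w : ℕ) :
    (-1 : ℂ) ^ w.choose 5 = if w % 8 = 5 ∨ w % 8 = 7 then -1 else 1 := by
  induction w using Nat.strong_induction_on with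
  | _ w ih =>
    rcases Nat.lt_or_ge w 8 with h | h
    · interval_cases w <;> norm_num [Nat.choose]
    · obtain ⟨v, rfl⟩ := Nat.exists_eq_add_of_le' h
      -- Vandermonde: the binomials 8, 28, 56, 70, 56 of 8 are all even.
      have hc : (v + 8).choose 5 = v.choose 5
          + 2 * (4 * v.choose 4 + 14 * v.choose 3 + 28 * v.choose 2 + 35 * v.choose 1 + 28) := by
        simp only [Nat.choose_succ_succ', Nat.choose_zero_right]
        ring
      rw [hc, pow_add, pow_mul, neg_one_sq, one_pow, mul_one, ih v (by omega), Nat.add_mod_right]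

theorem exists_weight_eq {N w : ℕ} (hw : w ≤ N) : ∃ x : Fin N → Fin 2, weight x = w := by
  refine ⟨fun i => if i.val < w then 1 else 0, ?_⟩
  have : ∀ i : Fin N, ((if i.val < w then (1 : Fin 2) else 0) = 1) = (i.val < w) := by
    intro i
    split_ifs with h <;> simp [h]
  simp only [weight, this]
  rw [Fin.card_filter_val_lt]
  omega

/-! ### The stabiliser conditions determine N mod 8. -/

/-- The bit string with all bits flipped. -/
def flipBits {N : ℕ} (x : Fin N → Fin 2) : Fin N → Fin 2 := fun i => 1 - x i

theorem weight_flipBits {N : ℕ} (x : Fin N → Fin 2) : weight (flipBits x) = N - weight x := by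
  rw [← card_filter_ne_one]
  unfold weight flipBits
  congr 2
  funext i
  generalize x i = b
  fin_cases b <;> simp

theorem tensorOp_offDiag_apply {N : ℕ} (α β : ℂ) (ψ : Ket N) (x : Fin N → Fin 2) :
    Matrix.toEuclideanLin (tensorOp fun _ : Fin N => !![0, α; β, 0]) ψ x
      = α ^ (N - weight x) * β ^ weight x * ψ (flipBits x) := by
  rw [Matrix.toLpLin_apply]
  simp only [Matrix.mulVec, dotProduct, tensorOp, Matrix.of_apply]
  rw [sum_eq_single (flipBits x)]
  · congr 1
    rw [← prod_vec_eq_pow]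
    refine prod_congr rfl fun i _ => ?_
    unfold flipBits
    generalize x i = b
    fin_cases b <;> simp
  · intro y _ hy
    obtain ⟨i, hi⟩ := Function.ne_iff.1 hy
    rw [prod_eq_zero (mem_univ i), zero_mul]
    unfold flipBits at hi
    revert hi
    generalize x i = b
    generalize y i = b'
    fin_cases b <;> fin_cases b' <;> simp
  · simp

theorem offDiag_stabilised_apply {N : ℕ} {α β : ℂ}
    (h : IsStabilisedBy (uniformCompleteState 5 N) (tensorOp fun _ : Fin N => !![0, α; β, 0]))
    {w : ℕ} (hw : w ≤ N) :
    α ^ (N - w) * β ^ w * (if (N - w) % 8 = 5 ∨ (N - w) % 8 = 7 then -1 else 1)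
      = if w % 8 = 5 ∨ w % 8 = 7 then -1 else 1 := by
  obtain ⟨x, rfl⟩ := exists_weight_eq hw
  have h1 := congrFun (congrArg WithLp.ofLp h) x
  rw [tensorOp_offDiag_apply, uniformCompleteState_apply, uniformCompleteState_apply,
    weight_flipBits, neg_one_pow_choose_five, neg_one_pow_choose_five, ← mul_assoc] at h1
  exact mul_right_cancel₀ (pow_ne_zero _ (by simp)) h1

/-- The signs must be symmetric under w ↦ N - w. The weight 5 leaves only N ≡ 2, 4 and the weight 7
only N ≡ 4, 6; weight 0 settles N = 5. -/
theorem mod_eight_of_pauliX {N : ℕ} (hN : 5 ≤ N)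
    (h : IsStabilisedBy (uniformCompleteState 5 N) (tensorOp fun _ : Fin N => pauliX)) :
    N % 8 = 4 := by
  have key := fun w hw => offDiag_stabilised_apply (w := w) h hw
  simp only [one_pow, one_mul] at key
  have hne : (-1 : ℂ) ≠ 1 := by norm_num
  have key' : ∀ w ≤ N, ((N - w) % 8 = 5 ∨ (N - w) % 8 = 7) ↔ (w % 8 = 5 ∨ w % 8 = 7) := by
    intro w hw
    have := key w hw
    split_ifs at this with h1 h2 h2
    · tauto
    · exact absurd this hne
    · exact absurd this hne.symm
    · tauto
  have h0 := key' 0 (by omega)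
  have h5 := key' 5 (by omega)
  rcases Nat.lt_or_ge N 7 with h7 | h7
  · omega
  · have h7 := key' 7 h7
    omega

/-- The signs must satisfy the flip relation up to the phase (-i)^N (-1)^w. Weight 0 leaves the
residues 0 and 4, and weight 1 excludes 4. -/
theorem mod_eight_of_pauliY {N : ℕ} (hN : 5 ≤ N)
    (h : IsStabilisedBy (uniformCompleteState 5 N) (tensorOp fun _ : Fin N => pauliY)) :
    N % 8 = 0 := by
  have key := fun w hw => offDiag_stabilised_apply (w := w) h hw
  have hI2 : Complex.I ^ 2 = -1 := Complex.I_sq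
  have hne : (-1 : ℂ) ≠ 1 := by norm_num
  have hpow : ∀ w ≤ N, (-Complex.I) ^ (N - w) * Complex.I ^ w = (-Complex.I) ^ N * (-1) ^ w := by
    intro w hw
    obtain ⟨v, rfl⟩ := Nat.exists_eq_add_of_le' hw
    rw [Nat.add_sub_cancel, pow_add, mul_assoc, ← mul_pow]
    congr 2
    ring
  have h0 := key 0 (by omega)
  have h1 := key 1 (by omega)
  rw [hpow _ (by omega)] at h0 h1
  have hμ : (-Complex.I) ^ N = (-Complex.I) ^ (N % 8) := by
    conv_lhs => rw [← Nat.div_add_mod N 8, pow_add, pow_mul]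
    have : (-Complex.I) ^ 8 = 1 := by
      linear_combination (Complex.I ^ 6 - Complex.I ^ 4 + Complex.I ^ 2 - 1) * hI2
    rw [this, one_pow, one_mul]
  rw [hμ] at h0 h1
  have e1 : (N - 1) % 8 = (N % 8 + 7) % 8 := by omega
  rw [e1] at h1
  rw [Nat.sub_zero] at h0
  have hlt : N % 8 < 8 := Nat.mod_lt _ (by norm_num)
  generalize N % 8 = r at *
  interval_cases r
  · rfl
  all_goals exfalso
  · norm_num [Complex.ext_iff, pow_succ] at h0
  · norm_num [Complex.ext_iff, pow_succ] at h0
  · norm_num [Complex.ext_iff, pow_succ] at h0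
  · norm_num [Complex.ext_iff, pow_succ] at h1
  · norm_num [Complex.ext_iff, pow_succ] at h0
  · norm_num [Complex.ext_iff, pow_succ] at h0
  · norm_num [Complex.ext_iff, pow_succ] at h0

/-! ### Fourier expansion and passage to the basis |+⟩, |-⟩. -/

theorem root_eq : ζ = 𝖼 + 𝗌 * Complex.I := by
  rw [Complex.exp_mul_I]
  push_cast
  rfl

theorem root_inv_eq : ζ⁻¹ = 𝖼 - 𝗌 * Complex.I := by
  rw [← Complex.exp_neg, ← neg_mul, Complex.exp_mul_I, Complex.cos_neg, Complex.sin_neg]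
  push_cast
  ring

theorem root_pow_four : ζ ^ 4 = Complex.I := by
  rw [← Complex.exp_nat_mul, show ((4 : ℕ) : ℂ) * (Real.pi / 8 * Complex.I)
    = Real.pi / 2 * Complex.I by push_cast; ring, Complex.exp_pi_div_two_mul_I]

/-- The amplitude of `|H^5_N⟩` at `k` minus signs in the basis `|+⟩, |-⟩`. -/
def hadamardAmplitude (N k : ℕ) : ℂ :=
  1 / 2 * (0 ^ k + 0 ^ (N - k)) + 1 / (2 * √2 * Complex.I) *
    ((ζ * 𝖼) ^ (N - k) * (ζ * (-Complex.I * 𝗌)) ^ k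
      - (ζ⁻¹ * 𝖼) ^ (N - k) * (ζ⁻¹ * (Complex.I * 𝗌)) ^ k
      + (ζ ^ 3 * 𝗌) ^ (N - k) * (ζ ^ 3 * (-Complex.I * 𝖼)) ^ k
      - (ζ⁻¹ ^ 3 * 𝗌) ^ (N - k) * (ζ⁻¹ ^ 3 * (Complex.I * 𝖼)) ^ k)

/-- The components of a dual vector in the basis `|+⟩, |-⟩`. -/
def hadamardComponent (u : Fin 2 → ℂ) : Fin 2 → ℂ :=
  ![(u 0 + u 1) / √2, (u 0 - u 1) / √2]

/-- Fourier expansion on ℤ/8. The four-term sum changes sign under w ↦ w + 4, vanishes at 0 and 2,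
and equals 2√2 i at 1 and 3, so it supplies the signs at odd weights. -/
theorem neg_one_pow_choose_five_eq (w : ℕ) :
    (-1 : ℂ) ^ w.choose 5 = 1 / 2 * (1 + (-1) ^ w) + 1 / (2 * √2 * Complex.I) *
      ((ζ ^ 2) ^ w - (ζ⁻¹ ^ 2) ^ w + (ζ ^ 6) ^ w - (ζ⁻¹ ^ 6) ^ w) := by
  have hz : ζ ≠ 0 := Complex.exp_ne_zero _
  have h4 := root_pow_four
  have hI : Complex.I ^ 2 = -1 := Complex.I_sq
  have hs : (√2 : ℂ) ^ 2 = 2 := by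
    rw [← Complex.ofReal_pow, Real.sq_sqrt (by norm_num)]; norm_num
  have hs0 : (√2 : ℂ) ≠ 0 := by simp
  have hi4 : ζ⁻¹ ^ 4 = -Complex.I := by rw [inv_pow, h4, Complex.inv_I]
  have h2 : ζ ^ 2 = (1 + Complex.I) / √2 := by
    rw [← Complex.exp_nat_mul, show ((2 : ℕ) : ℂ) * (Real.pi / 8 * Complex.I)
      = ((Real.pi / 4 : ℝ) : ℂ) * Complex.I by push_cast; ring, Complex.exp_mul_I, ← Complex.ofReal_cos,
      ← Complex.ofReal_sin, Real.cos_pi_div_four, Real.sin_pi_div_four]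
    push_cast
    field_simp
    linear_combination (1 + Complex.I) * hs
  have hi2 : ζ⁻¹ ^ 2 = (1 - Complex.I) / √2 := by
    rw [inv_pow, h2, inv_div, div_eq_div_iff (by simp [Complex.ext_iff]) hs0]
    linear_combination hs + hI
  have h6 : ζ ^ 6 = (Complex.I - 1) / √2 := by
    rw [show ζ ^ 6 = ζ ^ 4 * ζ ^ 2 by ring, h4, h2]
    field_simp
    linear_combination hI
  have hi6 : ζ⁻¹ ^ 6 = (-Complex.I - 1) / √2 := by
    rw [show ζ⁻¹ ^ 6 = ζ⁻¹ ^ 4 * ζ⁻¹ ^ 2 by ring, hi4, hi2]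
    field_simp
    linear_combination hI
  have a4 : (ζ ^ 2) ^ 4 = -1 := by
    rw [← pow_mul, show 2 * 4 = 4 * 2 by norm_num, pow_mul, h4, hI]
  have b4 : (ζ⁻¹ ^ 2) ^ 4 = -1 := by
    rw [← pow_mul, show 2 * 4 = 4 * 2 by norm_num, pow_mul, hi4, neg_sq, hI]
  have c4 : (ζ ^ 6) ^ 4 = -1 := by
    rw [← pow_mul, show 6 * 4 = 2 * 4 * 3 by norm_num, pow_mul, pow_mul, a4]; norm_num
  have d4 : (ζ⁻¹ ^ 6) ^ 4 = -1 := by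
    rw [← pow_mul, show 6 * 4 = 2 * 4 * 3 by norm_num, pow_mul, pow_mul, b4]; norm_num
  set S : ℕ → ℂ := fun w => (ζ ^ 2) ^ w - (ζ⁻¹ ^ 2) ^ w + (ζ ^ 6) ^ w - (ζ⁻¹ ^ 6) ^ w with hS
  change _ = _ + _ * S w
  have hS4 : ∀ w, S (w + 4) = -S w := by
    intro w
    simp only [hS, pow_add _ w 4, a4, b4, c4, d4]
    ring
  have hS0 : S 0 = 0 := by simp [hS]
  have hS1 : S 1 = 2 * √2 * Complex.I := by
    simp only [hS, pow_one, h2, hi2, h6, hi6]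
    field_simp
    linear_combination -2 * Complex.I * hs
  have hS2 : S 2 = 0 := by
    simp only [hS, h2, hi2, h6, hi6]
    field_simp
    ring
  have hS3 : S 3 = 2 * √2 * Complex.I := by
    simp only [hS, h2, hi2, h6, hi6]
    field_simp
    linear_combination (-2 * Complex.I * (√2 ^ 2 + 2)) * hs + 4 * Complex.I * hI
  have hne : 2 * √2 * Complex.I ≠ 0 := by simp
  rw [neg_one_pow_choose_five]
  induction w using Nat.strong_induction_on with
  | _ w ih =>
    rcases Nat.lt_or_ge w 8 with h | h
    · have hS5 := hS4 0
      have hS6 := hS4 1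
      have hS7 := hS4 2
      have hS8 := hS4 3
      rw [hS0] at hS5
      rw [hS1] at hS6
      rw [hS2] at hS7
      rw [hS3] at hS8
      norm_num at hS5 hS6 hS7 hS8
      have hinv : 1 / (2 * √2 * Complex.I) * (2 * √2 * Complex.I) = 1 := one_div_mul_cancel hne
      interval_cases w <;>
        simp only [hS0, hS1, hS2, hS3, hS5, hS6, hS7, hS8, mul_neg, hinv] <;> norm_num
    · obtain ⟨v, rfl⟩ := Nat.exists_eq_add_of_le' h
      have e : S (v + 8) = S v := by rw [hS4 (v + 4), hS4, neg_neg]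
      rw [Nat.add_mod_right, ih v (by omega), e, pow_add]
      norm_num

/-- Each Fourier mode is a product vector, so both sides are sums of six products over the qubits,
matched factor by factor: (1, β) has |±⟩ coordinates proportional to 1 ± β. For β = ζ² these halve
to ζ𝖼 and -iζ𝗌; for β = ζ⁶, to ζ³𝗌 and -iζ³𝖼. -/
theorem inner_productKet_uniformCompleteState {N : ℕ} (φ : Fin N → Qubit) :
    inner ℂ (productKet φ) (uniformCompleteState 5 N)
      = ∑ z : Fin N → Fin 2, hadamardAmplitude N (weight z) *
        ∏ i, hadamardComponent (fun b => starRingEnd ℂ (φ i b)) (z i) := by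
  have hz : ζ ≠ 0 := Complex.exp_ne_zero _
  have hI : Complex.I ^ 2 = -1 := Complex.I_sq
  have hsin : (𝗌 : ℂ) * Complex.I = ζ - 𝖼 := by rw [root_eq]; ring
  have hinv : ζ⁻¹ = 2 * 𝖼 - ζ := by rw [root_inv_eq, root_eq]; ring
  have h4 := root_pow_four
  set u : Fin N → Fin 2 → ℂ := fun i b => starRingEnd ℂ (φ i b) with hu
  have hlin : ∀ (A : ℂ) (α β γ δ ε η : (Fin N → Fin 2) → ℂ) (P : (Fin N → Fin 2) → ℂ),
      ∑ z, (1 / 2 * (α z + β z) + A * (γ z - δ z + ε z - η z)) * P z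
        = 1 / 2 * (∑ z, α z * P z + ∑ z, β z * P z)
          + A * (∑ z, γ z * P z - ∑ z, δ z * P z + ∑ z, ε z * P z - ∑ z, η z * P z) := by
    intros
    simp only [mul_sum, ← sum_add_distrib, ← sum_sub_distrib]
    exact sum_congr rfl fun z _ => by ring
  have hexp := fun a : Fin N → Fin 2 → ℂ => sum_pow_weight_mul_prod a
  obtain ⟨v, hv⟩ : ∃ v : Fin N → Fin 2 → ℂ, v = fun i b => u i b / √2 := ⟨_, rfl⟩
  obtain ⟨a, ha⟩ : ∃ a : Fin N → Fin 2 → ℂ, a = fun i => hadamardComponent (u i) := ⟨_, rfl⟩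
  have hleft : inner ℂ (productKet φ) (uniformCompleteState 5 N)
      = ∑ z : Fin N → Fin 2, (1 / 2 * (1 ^ (N - weight z) * 1 ^ weight z
          + 1 ^ (N - weight z) * (-1) ^ weight z) + 1 / (2 * √2 * Complex.I) *
        (1 ^ (N - weight z) * (ζ ^ 2) ^ weight z - 1 ^ (N - weight z) * (ζ⁻¹ ^ 2) ^ weight z
          + 1 ^ (N - weight z) * (ζ ^ 6) ^ weight z - 1 ^ (N - weight z) * (ζ⁻¹ ^ 6) ^ weight z)) *
        ∏ i, v i (z i) := by
    rw [PiLp.inner_apply]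
    refine sum_congr rfl fun z _ => ?_
    rw [uniformCompleteState_apply, neg_one_pow_choose_five_eq, RCLike.inner_apply]
    simp only [productKet, map_prod, one_pow, one_mul, prod_div_distrib, prod_const, card_univ,
      Fintype.card_fin, hv, hu, one_div, inv_pow]
    ring
  have hright : ∑ z : Fin N → Fin 2, hadamardAmplitude N (weight z)
        * ∏ i, hadamardComponent (u i) (z i)
      = ∑ z : Fin N → Fin 2, (1 / 2 * (1 ^ (N - weight z) * 0 ^ weight z
          + 0 ^ (N - weight z) * 1 ^ weight z) + 1 / (2 * √2 * Complex.I) *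
        ((ζ * 𝖼) ^ (N - weight z) * (ζ * (-Complex.I * 𝗌)) ^ weight z
          - (ζ⁻¹ * 𝖼) ^ (N - weight z) * (ζ⁻¹ * (Complex.I * 𝗌)) ^ weight z
          + (ζ ^ 3 * 𝗌) ^ (N - weight z) * (ζ ^ 3 * (-Complex.I * 𝖼)) ^ weight z
          - (ζ⁻¹ ^ 3 * 𝗌) ^ (N - weight z) * (ζ⁻¹ ^ 3 * (Complex.I * 𝖼)) ^ weight z)) *
        ∏ i, a i (z i) := by
    simp only [ha, hadamardAmplitude, one_pow, one_mul, mul_one]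
  rw [hleft, hright, hlin, hlin]
  simp only [hexp]
  have c0 : ∀ i, a i 0 = (u i 0 + u i 1) / √2 := fun i => by rw [ha]; rfl
  have c1 : ∀ i, a i 1 = (u i 0 - u i 1) / √2 := fun i => by rw [ha]; rfl
  have hzz : ζ * ζ⁻¹ = 1 := mul_inv_cancel₀ hz
  have h4' : ζ⁻¹ ^ 4 = -Complex.I := by rw [inv_pow, h4, Complex.inv_I]
  have e1 : (𝖼 : ℂ) = (ζ + ζ⁻¹) / 2 := by rw [hinv]; ring
  have e2 : (𝗌 : ℂ) = (ζ⁻¹ - ζ) / 2 * Complex.I := by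
    linear_combination (-Complex.I) * hsin + 𝗌 * hI - Complex.I / 2 * hinv
  rw [e1, e2]
  clear hinv hsin e1 e2 hleft hright
  -- Only the relations y y' = 1, y⁴ = i and y'⁴ = -i are needed from here.
  generalize ζ⁻¹ = y' at *
  generalize ζ = y at *
  have f1 : y * ((y + y') / 2) = (1 + y ^ 2) / 2 := by linear_combination hzz / 2
  have f2 : y * (-Complex.I * ((y' - y) / 2 * Complex.I)) = (1 - y ^ 2) / 2 := by
    linear_combination (-(y * y' - y ^ 2) / 2) * hI + hzz / 2
  have f3 : y' * ((y + y') / 2) = (1 + y' ^ 2) / 2 := by linear_combination hzz / 2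
  have f4 : y' * (Complex.I * ((y' - y) / 2 * Complex.I)) = (1 - y' ^ 2) / 2 := by
    linear_combination ((y' ^ 2 - y * y') / 2) * hI + hzz / 2
  have f5 : y ^ 3 * ((y' - y) / 2 * Complex.I) = (1 + y ^ 6) / 2 := by
    linear_combination y ^ 2 * Complex.I / 2 * hzz - (y ^ 2 + Complex.I) / 2 * h4 - hI / 2
  have f6 : y ^ 3 * (-Complex.I * ((y + y') / 2)) = (1 - y ^ 6) / 2 := by
    linear_combination -Complex.I * y ^ 2 / 2 * hzz + (y ^ 2 - Complex.I) / 2 * h4 - hI / 2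
  have f7 : y' ^ 3 * ((y' - y) / 2 * Complex.I) = (1 + y' ^ 6) / 2 := by
    linear_combination -Complex.I * y' ^ 2 / 2 * hzz + (Complex.I - y' ^ 2) / 2 * h4' - hI / 2
  have f8 : y' ^ 3 * (Complex.I * ((y + y') / 2)) = (1 - y' ^ 6) / 2 := by
    linear_combination Complex.I * y' ^ 2 / 2 * hzz + (Complex.I + y' ^ 2) / 2 * h4' - hI / 2
  have hc : ∀ (i : Fin N) (β : ℂ),
      1 * v i 0 + β * v i 1 = (1 + β) / 2 * a i 0 + (1 - β) / 2 * a i 1 := by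
    intro i β
    rw [c0, c1, hv]
    ring
  rw [f1, f2, f3, f4, f5, f6, f7, f8]
  simp only [hc]
  norm_num

theorem norm_hadamardComponent {u : Fin 2 → ℂ} (hu : ‖u 0‖ ^ 2 + ‖u 1‖ ^ 2 = 1) :
    ‖hadamardComponent u 0‖ ^ 2 + ‖hadamardComponent u 1‖ ^ 2 = 1 := by
  have h : ‖u 0 + u 1‖ ^ 2 + ‖u 0 - u 1‖ ^ 2 = 2 := by
    have := parallelogram_law_with_norm ℝ (u 0) (u 1)
    nlinarith
  simp only [hadamardComponent, Matrix.cons_val_zero, Matrix.cons_val_one, norm_div, div_pow,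
    Complex.norm_real, Real.norm_eq_abs, sq_abs, Real.sq_sqrt (show (0 : ℝ) ≤ 2 by norm_num)]
  linarith

/-- Reduction of the overlap bound to symmetric nonnegative product vectors. -/
theorem norm_inner_le_of_amplitude_le {N : ℕ} (hN : N ≠ 0) {D : (Fin N → Fin 2) → ℝ}
    (hD : ∀ z, ‖hadamardAmplitude N (weight z)‖ ≤ D z)
    (hsymm : ∀ (σ : Equiv.Perm (Fin N)) z, D (z ∘ σ) = D z) {M : ℝ}
    (hM : ∀ v : Fin 2 → ℝ, (∀ b, 0 ≤ v b) → v 0 ^ 2 + v 1 ^ 2 = 1 → ∑ z, D z * ∏ i, v (z i) ≤ M)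
    {φ : Fin N → Qubit} (hφ : ∀ i, ‖φ i‖ = 1) :
    ‖inner ℂ (productKet φ) (uniformCompleteState 5 N)‖ ≤ M := by
  have : Nonempty (Fin N) := Fin.pos_iff_nonempty.1 (by omega)
  have hmem : (fun i b => ‖hadamardComponent (fun b => starRingEnd ℂ (φ i b)) b‖)
      ∈ quadrantUnitVectors (Fin N) := by
    intro i
    refine ⟨fun b => norm_nonneg _, norm_hadamardComponent ?_⟩
    have h := EuclideanSpace.norm_sq_eq (φ i)
    rw [hφ i, Fin.sum_univ_two] at h
    simp only [RCLike.norm_conj]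
    linarith
  refine le_trans ?_ (sum_mul_prod_le_of_symmetric (fun z => (norm_nonneg _).trans (hD z)) hsymm hM hmem)
  rw [inner_productKet_uniformCompleteState]
  refine norm_sum_le_of_le _ fun z _ => ?_
  rw [norm_mul, norm_prod]
  exact mul_le_mul_of_nonneg_right (hD z) (by positivity)

/-! ### Amplitudes for N ≡ 4 and N ≡ 0 mod 8, and their majorants. -/

theorem hadamardAmplitude_eq {N k : ℕ} (hk : k ≤ N) :
    hadamardAmplitude N k = 1 / 2 * (0 ^ k + 0 ^ (N - k)) + 1 / (2 * √2 * Complex.I) *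
      ((ζ ^ N * (-Complex.I) ^ k - ζ⁻¹ ^ N * Complex.I ^ k) * (𝖼 ^ (N - k) * 𝗌 ^ k)
        + ((ζ ^ N) ^ 3 * (-Complex.I) ^ k - (ζ⁻¹ ^ N) ^ 3 * Complex.I ^ k)
          * (𝗌 ^ (N - k) * 𝖼 ^ k)) := by
  obtain ⟨j, rfl⟩ := Nat.exists_eq_add_of_le' hk
  unfold hadamardAmplitude
  simp only [Nat.add_sub_cancel, mul_pow, pow_add]
  ring

theorem hadamardAmplitude_of_mod_eight_eq_four {m k : ℕ} (hk : k ≤ 8 * m + 4) :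
    hadamardAmplitude (8 * m + 4) k = 1 / 2 * (0 ^ k + 0 ^ (8 * m + 4 - k)) +
      (-1) ^ m / (2 * √2) * (((-Complex.I) ^ k + Complex.I ^ k) *
        (𝖼 ^ (8 * m + 4 - k) * 𝗌 ^ k - 𝗌 ^ (8 * m + 4 - k) * 𝖼 ^ k)) := by
  have hI : Complex.I ^ 2 = -1 := Complex.I_sq
  have h1 : ζ ^ (8 * m + 4) = (-1) ^ m * Complex.I := by
    rw [pow_add, pow_mul, show ζ ^ 8 = (ζ ^ 4) ^ 2 by ring, root_pow_four, hI]
  have h2 : ζ⁻¹ ^ (8 * m + 4) = -((-1) ^ m * Complex.I) := by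
    rw [inv_pow, h1, mul_inv, Complex.inv_I, ← inv_pow]
    norm_num
  have h3 : ((-1 : ℂ) ^ m) ^ 3 = (-1) ^ m := by
    rw [← pow_mul, mul_comm, pow_mul]; norm_num
  have h4 : Complex.I ^ 3 = -Complex.I := Complex.I_pow_three
  have h5 : (-((-1 : ℂ) ^ m * Complex.I)) ^ 3 = (-1) ^ m * Complex.I := by
    rw [neg_pow ((-1 : ℂ) ^ m * Complex.I), mul_pow ((-1 : ℂ) ^ m), h3, h4]
    ring
  rw [hadamardAmplitude_eq hk, h1, h2, h5, mul_pow ((-1 : ℂ) ^ m), h3, h4]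
  field_simp
  ring

theorem hadamardAmplitude_of_mod_eight_eq_zero {m k : ℕ} (hk : k ≤ 8 * m) :
    hadamardAmplitude (8 * m) k = 1 / 2 * (0 ^ k + 0 ^ (8 * m - k)) +
      (-1) ^ m / (2 * √2 * Complex.I) * (((-Complex.I) ^ k - Complex.I ^ k) *
        (𝖼 ^ (8 * m - k) * 𝗌 ^ k + 𝗌 ^ (8 * m - k) * 𝖼 ^ k)) := by
  have hI : Complex.I ^ 2 = -1 := Complex.I_sq
  have h1 : ζ ^ (8 * m) = (-1) ^ m := by
    rw [pow_mul, show ζ ^ 8 = (ζ ^ 4) ^ 2 by ring, root_pow_four, hI]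
  have h2 : ζ⁻¹ ^ (8 * m) = (-1) ^ m := by
    rw [inv_pow, h1, ← inv_pow]
    norm_num
  have h3 : ((-1 : ℂ) ^ m) ^ 3 = (-1) ^ m := by
    rw [← pow_mul, mul_comm, pow_mul]; norm_num
  rw [hadamardAmplitude_eq hk, h1, h2, h3]
  ring

theorem norm_neg_I_pow_add (k : ℕ) : ‖(-Complex.I) ^ k + Complex.I ^ k‖ = 1 + (-1) ^ k := by
  rcases Nat.even_or_odd k with h | h
  · rw [h.neg_pow, h.neg_pow, ← two_mul, norm_mul, norm_pow]
    norm_num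
  · rw [h.neg_pow, h.neg_pow]
    norm_num

theorem norm_neg_I_pow_sub (k : ℕ) : ‖(-Complex.I) ^ k - Complex.I ^ k‖ = 1 - (-1) ^ k := by
  rcases Nat.even_or_odd k with h | h
  · rw [h.neg_pow, h.neg_pow]
    norm_num
  · rw [h.neg_pow, h.neg_pow, ← neg_add', ← two_mul, norm_neg, norm_mul, norm_pow]
    norm_num

theorem norm_half_zero_pow (k l : ℕ) :
    ‖(1 / 2 * (0 ^ k + 0 ^ l) : ℂ)‖ = 1 / 2 * (0 ^ k + 0 ^ l : ℝ) := by
  have : (1 / 2 * (0 ^ k + 0 ^ l) : ℂ) = ((1 / 2 * (0 ^ k + 0 ^ l) : ℝ) : ℂ) := by push_cast; ring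
  rw [this, Complex.norm_real, Real.norm_of_nonneg (by positivity)]

/-- A nonnegative majorant of the amplitudes when `N ≡ 4 mod 8`. -/
def evenMajorant (N k : ℕ) : ℝ :=
  ghzWeight N * (1 ^ (N - k) * 0 ^ k + 0 ^ (N - k) * 1 ^ k) +
    1 / (2 * √2) * (𝖼 ^ (N - k) * 𝗌 ^ k + 𝖼 ^ (N - k) * (-𝗌) ^ k +
      𝗌 ^ (N - k) * 𝖼 ^ k + 𝗌 ^ (N - k) * (-𝖼) ^ k)

/-- A nonnegative majorant of the amplitudes when `N ≡ 0 mod 8`. -/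
def oddMajorant (N k : ℕ) : ℝ :=
  1 / 2 * (1 ^ (N - k) * 0 ^ k + 0 ^ (N - k) * 1 ^ k) +
    1 / (2 * √2) * (𝖼 ^ (N - k) * 𝗌 ^ k - 𝖼 ^ (N - k) * (-𝗌) ^ k +
      𝗌 ^ (N - k) * 𝖼 ^ k - 𝗌 ^ (N - k) * (-𝖼) ^ k)

/-- For 0 < k < N the difference of the two monomials is bounded by their sum. At k = 0 and k = N
that would cost √2 𝗌^N, exactly what `ghzWeight` removes. -/
theorem norm_hadamardAmplitude_le_evenMajorant {m k : ℕ} (hk : k ≤ 8 * m + 4) :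
    ‖hadamardAmplitude (8 * m + 4) k‖ ≤ evenMajorant (8 * m + 4) k := by
  rw [hadamardAmplitude_of_mod_eight_eq_four hk]
  have hc := cos_pi_div_eight_pos
  have hs := sin_pi_div_eight_pos
  have hs2 : √2 ^ 2 = 2 := Real.sq_sqrt (by norm_num)
  set N := 8 * m + 4 with hN
  refine (norm_add_le _ _).trans ?_
  rw [norm_half_zero_pow, norm_mul, norm_mul, norm_neg_I_pow_add]
  have e1 : ‖((-1) ^ m / (2 * √2) : ℂ)‖ = 1 / (2 * √2) := by
    simp [abs_of_nonneg]
  have e2 : ‖(𝖼 ^ (N - k) * 𝗌 ^ k - 𝗌 ^ (N - k) * 𝖼 ^ k : ℂ)‖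
      = |𝖼 ^ (N - k) * 𝗌 ^ k - 𝗌 ^ (N - k) * 𝖼 ^ k| := by
    rw [← Real.norm_eq_abs, ← Complex.norm_real]
    push_cast
    rfl
  have e3 : ∀ x : ℝ, (-x) ^ k = (-1) ^ k * x ^ k := fun x => by rw [← mul_pow, neg_one_mul]
  have hroot : √2 = 1 / (2 * √2) * 4 := by
    field_simp
    linarith
  have hle : 𝗌 ^ N ≤ 𝖼 ^ N := pow_le_pow_left₀ hs.le sin_le_cos_pi_div_eight N
  have hNe : (-1 : ℝ) ^ N = 1 := Even.neg_one_pow ⟨4 * m + 2, by omega⟩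
  rw [e1, e2, evenMajorant, e3 𝗌, e3 𝖼, ghzWeight]
  have hN0 : N ≠ 0 := by omega
  rcases Nat.eq_zero_or_pos k with rfl | hk0
  · simp only [Nat.sub_zero, pow_zero, mul_one, one_pow, zero_pow hN0,
      abs_of_nonneg (sub_nonneg.2 hle)]
    linear_combination 𝗌 ^ N * hroot
  rcases hk.lt_or_eq with hlt | rfl
  · have h1 : N - k ≠ 0 := by omega
    have hA : 0 ≤ 𝖼 ^ (N - k) * 𝗌 ^ k := by positivity
    have hB : 0 ≤ 𝗌 ^ (N - k) * 𝖼 ^ k := by positivity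
    have hab : |𝖼 ^ (N - k) * 𝗌 ^ k - 𝗌 ^ (N - k) * 𝖼 ^ k|
        ≤ 𝖼 ^ (N - k) * 𝗌 ^ k + 𝗌 ^ (N - k) * 𝖼 ^ k := abs_le.2 ⟨by linarith, by linarith⟩
    have hsg : 0 ≤ 1 + (-1 : ℝ) ^ k := by
      rcases neg_one_pow_eq_or ℝ k with h | h <;> rw [h] <;> norm_num
    have h0 : 0 ≤ 1 / (2 * √2) := by positivity
    have := mul_le_mul_of_nonneg_left (mul_le_mul_of_nonneg_left hab hsg) h0
    simp only [zero_pow h1, zero_pow hk0.ne', mul_zero, zero_mul, add_zero, zero_add]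
    linarith
  · simp only [Nat.sub_self, pow_zero, mul_one, one_pow, zero_pow hN0, one_mul, hNe,
      abs_sub_comm (𝗌 ^ N), abs_of_nonneg (sub_nonneg.2 hle)]
    linear_combination 𝗌 ^ N * hroot

theorem norm_hadamardAmplitude_le_oddMajorant {m k : ℕ} (hk : k ≤ 8 * m) :
    ‖hadamardAmplitude (8 * m) k‖ ≤ oddMajorant (8 * m) k := by
  rw [hadamardAmplitude_of_mod_eight_eq_zero hk]
  have hc := cos_pi_div_eight_pos
  have hs := sin_pi_div_eight_pos
  set N := 8 * m with hN
  refine (norm_add_le _ _).trans ?_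
  rw [norm_half_zero_pow, norm_mul, norm_mul, norm_neg_I_pow_sub]
  have e1 : ‖((-1) ^ m / (2 * √2 * Complex.I) : ℂ)‖ = 1 / (2 * √2) := by
    simp [abs_of_nonneg]
  have e2 : ‖(𝖼 ^ (N - k) * 𝗌 ^ k + 𝗌 ^ (N - k) * 𝖼 ^ k : ℂ)‖
      = 𝖼 ^ (N - k) * 𝗌 ^ k + 𝗌 ^ (N - k) * 𝖼 ^ k := by
    rw [← Real.norm_of_nonneg (show 0 ≤ 𝖼 ^ (N - k) * 𝗌 ^ k + 𝗌 ^ (N - k) * 𝖼 ^ k by positivity),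
      ← Complex.norm_real]
    push_cast
    rfl
  have e3 : ∀ x : ℝ, (-x) ^ k = (-1) ^ k * x ^ k := fun x => by rw [← mul_pow, neg_one_mul]
  rw [e1, e2, oddMajorant, e3 𝗌, e3 𝖼, one_pow, one_pow]
  apply le_of_eq
  ring

theorem weight_comp_perm {N : ℕ} (σ : Equiv.Perm (Fin N)) (z : Fin N → Fin 2) :
    weight (z ∘ σ) = weight z := by
  unfold weight
  refine card_bij (fun i _ => σ i) ?_ ?_ ?_
  · intro i hi; simpa using hi
  · intro i _ j _ h; exact σ.injective h
  · intro i hi; exact ⟨σ.symm i, by simpa using hi, by simp⟩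

theorem sum_evenMajorant (n : ℕ) (v : Fin 2 → ℝ) :
    ∑ z : Fin (2 * n) → Fin 2, evenMajorant (2 * n) (weight z) * ∏ i, v (z i)
      = profile n (v 0) (v 1) := by
  have key := fun α β : ℝ => sum_pow_weight_mul_prod (fun _ : Fin (2 * n) => v) α β
  simp only [prod_const, card_univ, Fintype.card_fin] at key
  have hlin : ∀ z : Fin (2 * n) → Fin 2, evenMajorant (2 * n) (weight z) * ∏ i, v (z i)
      = ghzWeight (2 * n) * ((1 ^ (2 * n - weight z) * 0 ^ weight z) * ∏ i, v (z i)
          + (0 ^ (2 * n - weight z) * 1 ^ weight z) * ∏ i, v (z i))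
        + 1 / (2 * √2) * ((𝖼 ^ (2 * n - weight z) * 𝗌 ^ weight z) * ∏ i, v (z i)
          + (𝖼 ^ (2 * n - weight z) * (-𝗌) ^ weight z) * ∏ i, v (z i)
          + (𝗌 ^ (2 * n - weight z) * 𝖼 ^ weight z) * ∏ i, v (z i)
          + (𝗌 ^ (2 * n - weight z) * (-𝖼) ^ weight z) * ∏ i, v (z i)) := by
    intro z
    unfold evenMajorant
    ring
  simp only [hlin, sum_add_distrib, ← mul_sum, key]
  unfold profile
  simp only [one_mul, zero_mul, add_zero, zero_add, neg_mul, ← sub_eq_add_neg]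

theorem sum_oddMajorant (n : ℕ) (v : Fin 2 → ℝ) :
    ∑ z : Fin (2 * n) → Fin 2, oddMajorant (2 * n) (weight z) * ∏ i, v (z i)
      = 1 / 2 * (v 0 ^ (2 * n) + v 1 ^ (2 * n)) +
        1 / (2 * √2) * ((𝖼 * v 0 + 𝗌 * v 1) ^ (2 * n) - (𝖼 * v 0 - 𝗌 * v 1) ^ (2 * n) +
          (𝗌 * v 0 + 𝖼 * v 1) ^ (2 * n) - (𝗌 * v 0 - 𝖼 * v 1) ^ (2 * n)) := by
  have key := fun α β : ℝ => sum_pow_weight_mul_prod (fun _ : Fin (2 * n) => v) α β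
  simp only [prod_const, card_univ, Fintype.card_fin] at key
  have hlin : ∀ z : Fin (2 * n) → Fin 2, oddMajorant (2 * n) (weight z) * ∏ i, v (z i)
      = 1 / 2 * ((1 ^ (2 * n - weight z) * 0 ^ weight z) * ∏ i, v (z i)
          + (0 ^ (2 * n - weight z) * 1 ^ weight z) * ∏ i, v (z i))
        + 1 / (2 * √2) * ((𝖼 ^ (2 * n - weight z) * 𝗌 ^ weight z) * ∏ i, v (z i)
          - (𝖼 ^ (2 * n - weight z) * (-𝗌) ^ weight z) * ∏ i, v (z i)
          + (𝗌 ^ (2 * n - weight z) * 𝖼 ^ weight z) * ∏ i, v (z i)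
          - (𝗌 ^ (2 * n - weight z) * (-𝖼) ^ weight z) * ∏ i, v (z i)) := by
    intro z
    unfold oddMajorant
    ring
  simp only [hlin, sum_add_distrib, sum_sub_distrib, ← mul_sum, key]
  simp only [one_mul, zero_mul, add_zero, zero_add, neg_mul, ← sub_eq_add_neg]

/-! ### Explicit overlaps and the two-sided bounds. -/

/-- The overlaps with `|+⟩^{⊗ N}` and `|-⟩^{⊗ N}`. -/
theorem exists_overlap_eq_amplitude {N : ℕ} (b : Fin 2) :
    ∃ φ : Fin N → Qubit, (∀ i, ‖φ i‖ = 1) ∧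
      inner ℂ (productKet φ) (uniformCompleteState 5 N)
        = hadamardAmplitude N (weight fun _ : Fin N => b) := by
  have hs : (√2 : ℂ) * √2 = 2 := by
    rw [← Complex.ofReal_mul, Real.mul_self_sqrt (by norm_num)]; norm_num
  have hs0 : (√2 : ℂ) ≠ 0 := by simp
  have hcomp : ∀ b b' : Fin 2, hadamardComponent
      (fun b'' => starRingEnd ℂ ((!₂[1 / (√2 : ℂ), (-1) ^ (b : ℕ) / (√2 : ℂ)] : Qubit) b'')) b'
        = if b' = b then 1 else 0 := by
    intro b b'
    fin_cases b <;> fin_cases b' <;> simp [hadamardComponent, Complex.conj_ofReal] <;> field_simp <;>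
      first | ring1 | linear_combination -hs
  refine ⟨fun _ => !₂[1 / (√2 : ℂ), (-1) ^ (b : ℕ) / (√2 : ℂ)], fun _ => ?_, ?_⟩
  · rw [EuclideanSpace.norm_eq, Fin.sum_univ_two]
    simp [abs_of_nonneg]
    norm_num
  · rw [inner_productKet_uniformCompleteState, sum_eq_single (fun _ => b)]
    · simp only [hcomp, if_true, prod_const_one, mul_one]
    · intro z _ hz
      obtain ⟨i, hi⟩ := Function.ne_iff.1 hz
      rw [prod_eq_zero (mem_univ i), mul_zero]
      rw [hcomp, if_neg hi]
    · simp

theorem weight_const_zero (N : ℕ) : weight (fun _ : Fin N => (0 : Fin 2)) = 0 := by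
  simp [weight]

theorem weight_const_one (N : ℕ) : weight (fun _ : Fin N => (1 : Fin 2)) = N := by
  simp [weight]

theorem geometricMeasure_le {N : ℕ} {ψ : Ket N} {φ : Fin N → Qubit} (hφ : ∀ i, ‖φ i‖ = 1) :
    geometricMeasure ψ ≤ 1 - ‖inner ℂ (productKet φ) ψ‖ ^ 2 := by
  have := (isGreatest_productOverlaps ψ).2 ⟨φ, hφ, rfl⟩
  unfold geometricMeasure
  linarith

theorem le_geometricMeasure {N : ℕ} {ψ : Ket N} {M : ℝ}
    (h : ∀ φ : Fin N → Qubit, (∀ i, ‖φ i‖ = 1) → ‖inner ℂ (productKet φ) ψ‖ ≤ M) :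
    1 - M ^ 2 ≤ geometricMeasure ψ := by
  obtain ⟨φ, hφ, ht⟩ := (isGreatest_productOverlaps ψ).1
  have := pow_le_pow_left₀ (norm_nonneg _) (h φ hφ) 2
  unfold geometricMeasure
  linarith

theorem le_geometricMeasure_of_mod_eight_eq_four {N : ℕ} (hN : 5 ≤ N) (h : N % 8 = 4) :
    1 - (1 / 2 + lam N) ^ 2 ≤ geometricMeasure (uniformCompleteState 5 N) := by
  obtain ⟨m, rfl⟩ : ∃ m, N = 8 * m + 4 := ⟨N / 8, by omega⟩
  refine le_geometricMeasure fun φ hφ => norm_inner_le_of_amplitude_le (by omega)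
    (D := fun z => evenMajorant _ (weight z))
    (fun z => norm_hadamardAmplitude_le_evenMajorant (weight_le z))
    (fun σ z => by rw [weight_comp_perm]) (fun v hv hv1 => ?_) hφ
  have e : 8 * m + 4 = 2 * (4 * m + 2) := by ring
  rw [e, sum_evenMajorant]
  exact profile_le (by omega) (hv 0) (hv 1) hv1

theorem le_geometricMeasure_of_mod_eight_eq_zero {N : ℕ} (hN : 5 ≤ N) (h : N % 8 = 0) :
    1 - (1 / 2 + lam N) ^ 2 ≤ geometricMeasure (uniformCompleteState 5 N) := by
  obtain ⟨m, rfl⟩ : ∃ m, N = 8 * m := ⟨N / 8, by omega⟩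
  refine le_geometricMeasure fun φ hφ => norm_inner_le_of_amplitude_le (by omega)
    (D := fun z => oddMajorant _ (weight z))
    (fun z => norm_hadamardAmplitude_le_oddMajorant (weight_le z))
    (fun σ z => by rw [weight_comp_perm]) (fun v hv hv1 => ?_) hφ
  have e : 8 * m = 2 * (4 * m) := by ring
  rw [e, sum_oddMajorant]
  exact oddProfile_le (by omega) (hv 0) (hv 1) hv1

/-- With N = 8m + 4, the amplitudes at |+⟩^{⊗N} and |-⟩^{⊗N} are 1/2 ± (-1)^m λ_N, so the parity of
m decides which one reaches 1/2 + λ_N. -/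
theorem geometricMeasure_le_of_mod_eight_eq_four {N : ℕ} (h : N % 8 = 4) :
    geometricMeasure (uniformCompleteState 5 N) ≤ 1 - (1 / 2 + lam N) ^ 2 := by
  obtain ⟨m, rfl⟩ : ∃ m, N = 8 * m + 4 := ⟨N / 8, by omega⟩
  suffices h : ∃ b : Fin 2, ‖hadamardAmplitude (8 * m + 4) (weight fun _ : Fin (8 * m + 4) => b)‖
      = 1 / 2 + lam (8 * m + 4) by
    obtain ⟨b, hb⟩ := h
    obtain ⟨φ, hφ, hφ'⟩ := exists_overlap_eq_amplitude (N := 8 * m + 4) b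
    rw [← hb, ← hφ']
    exact geometricMeasure_le hφ
  have hnorm : ‖(((1 / 2 + lam (8 * m + 4) : ℝ)) : ℂ)‖ = 1 / 2 + lam (8 * m + 4) := by
    rw [Complex.norm_real, Real.norm_of_nonneg]
    linarith [lam_nonneg (8 * m + 4)]
  have hIN : Complex.I ^ (8 * m + 4) = 1 := by
    rw [show 8 * m + 4 = 4 * (2 * m + 1) by ring, pow_mul, Complex.I_pow_four, one_pow]
  have hIN' : (-Complex.I) ^ (8 * m + 4) = 1 := by
    rw [Even.neg_pow ⟨4 * m + 2, by omega⟩, hIN]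
  rcases neg_one_pow_eq_or ℂ m with hm | hm
  · refine ⟨0, ?_⟩
    rw [weight_const_zero, hadamardAmplitude_of_mod_eight_eq_four (Nat.zero_le _), hm, ← hnorm]
    congr 1
    unfold lam
    push_cast
    simp only [pow_zero, zero_pow (show 8 * m + 4 ≠ 0 by omega)]
    field_simp
    ring
  · refine ⟨1, ?_⟩
    rw [weight_const_one, hadamardAmplitude_of_mod_eight_eq_four le_rfl, hm, hIN, hIN', ← hnorm]
    congr 1
    unfold lam
    push_cast
    simp only [Nat.sub_self, pow_zero, zero_pow (show 8 * m + 4 ≠ 0 by omega)]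
    field_simp
    ring

theorem geometricMeasure_le_of_mod_eight_eq_zero {N : ℕ} (hN : 5 ≤ N) (h : N % 8 = 0) :
    geometricMeasure (uniformCompleteState 5 N) ≤ 3 / 4 := by
  obtain ⟨m, rfl⟩ : ∃ m, N = 8 * m := ⟨N / 8, by omega⟩
  obtain ⟨φ, hφ, hφ'⟩ := exists_overlap_eq_amplitude (N := 8 * m) 0
  refine (geometricMeasure_le hφ).trans ?_
  rw [hφ', weight_const_zero, hadamardAmplitude_of_mod_eight_eq_zero (Nat.zero_le _)]
  simp only [Nat.sub_zero, pow_zero, zero_pow (show 8 * m ≠ 0 by omega)]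
  norm_num

end QHyper

end

theorem mainTheorem3 (N : ℕ) (hN : 5 ≤ N) :
    (QHyper.IsStabilisedBy (QHyper.uniformCompleteState 5 N)
        (QHyper.tensorOp fun _ : Fin N => QHyper.pauliX) →
      QHyper.geometricMeasure (QHyper.uniformCompleteState 5 N)
        = 3 / 4 - QHyper.lam N - QHyper.lam N ^ 2) ∧
    (QHyper.IsStabilisedBy (QHyper.uniformCompleteState 5 N)
        (QHyper.tensorOp fun _ : Fin N => QHyper.pauliY) →
      3 / 4 - QHyper.lam N - QHyper.lam N ^ 2
          ≤ QHyper.geometricMeasure (QHyper.uniformCompleteState 5 N) ∧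
        QHyper.geometricMeasure (QHyper.uniformCompleteState 5 N) ≤ 3 / 4) := by
  have e : 1 - (1 / 2 + QHyper.lam N) ^ 2 = 3 / 4 - QHyper.lam N - QHyper.lam N ^ 2 := by ring
  rw [← e]
  refine ⟨fun h => ?_, fun h => ?_⟩
  · have h4 := QHyper.mod_eight_of_pauliX hN h
    exact le_antisymm (QHyper.geometricMeasure_le_of_mod_eight_eq_four h4)
      (QHyper.le_geometricMeasure_of_mod_eight_eq_four hN h4)
  · have h0 := QHyper.mod_eight_of_pauliY hN h
    exact ⟨QHyper.le_geometricMeasure_of_mod_eight_eq_zero hN h0,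
      QHyper.geometricMeasure_le_of_mod_eight_eq_zero hN h0⟩
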